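/- Let $d\ge 1$, $k\ge 0$, and let $\Omega\subset\mathbb R^d$ be open. Consider a system $\sum_{j=1}^d\partial_{x_j} f_j(u)=0$ of $p$ conservation laws with states in an open set $\mathcal D\subset\mathbb R^p$, with an entropy pair $(U,g)$: $U$ is convex on the convex set $\mathcal D$ with positive definite Hessian, $\nabla U\cdot\nabla f_j=\nabla g_j$, and $f,U,g$ are of class $C^{k+2}$. Let $V=\nabla U(u)$ be the entropy variable; as $u\mapsto V$ is one-to-one, write $f(V)$, $g(V)$ for $f(u(V))$, $g(u(V))$, and let $\theta_j(V)=\langle V,f_j(V)\rangle-g_j(V)$. Let $u\in C^{k+2}(\overline\Omega)$, with values in $\mathcal D$, be a steady solution, $\sum_j\partial_{x_j}f_j(u)=0$ in $\Omega$, and let $V(x)=\nabla U(u(x))$. Let $\hat f_{\mathbf n}(a,b)$ be a consistent numerical flux in the entropy variables ($\hat f_{\mathbf n}(a,a)=f(a)\cdot\mathbf n$), Lipschitz continuous on compact sets of states uniformly in the unit vector $\mathbf n$, and set, with $\{V\}=\tfrac12(a+b)$, $$\hat g_{\mathbf n}(a,b)=\langle\{V\},\hat f_{\mathbf n}(a,b)\rangle-\theta(\{V\})\cdot\mathbf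 n .$$ Let $(\mathcal T_h)$ be a family of finite conforming simplicial triangulations of $\Omega$, $h$ being the largest cell diameter. Fix a basis $(\hat\varphi_\sigma)_\sigma$ of the polynomials of degree at most $k$ on the reference simplex with $\sum_\sigma\hat\varphi_\sigma=1$, and let $\varphi_\sigma$ be its affine transport to a cell $K$. Let $V^h$ be given on each cell by $V^h|_K=\sum_{\sigma\in K}V_\sigma\varphi_\sigma$, with no continuity required across faces, and assume that it approximates $V$ with order $k+1$: $\max_K\sup_{K}|V^h|_K-V|=O(h^{k+1})$. On a face of $K$ shared with another cell, $V^h|_{K^-}$ is the restriction of $V^h$ to that cell; on a face in $\partial\Omega$ it is $V^h|_K$. On each face $f$ of each cell let $\oint_f v\,d\gamma=|f|\sum_q\omega_q v(x_q)$ be a quadrature formula with nodes $x_q\in f$ and $\sum_q|\omega_q|$ bounded uniformly over all faces and meshes, and let $\oint_{\partial K}$ be the sum over the faces of $K$. Assume that the boundary quadrature is of order $k$ in the sense that, for every vector field $\psi\in C^{k+2}(\overline\Omega;\mathbb R^d)$, uniformly in $K$, $$\oint_{\partial K}\psi\cdot\mathbf n\,d\gamma=\int_{\partial K}\psi\cdot\mathbf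 n\,d\gamma+O(h^{k+d+1}).$$ Consider residuals $\Phi_\sigma=\beta_\sigma\Phi$ with $\Phi=\oint_{\partial K}\hat f_{\mathbf n}(V^h|_K,V^h|_{K^-})\,d\gamma$, where the $p\times p$ matrices $\beta_\sigma$ may depend on $K$ and on $V^h$, satisfy $\sum_{\sigma\in K}\beta_\sigma=\mathrm{Id}$ and are uniformly bounded. Define the entropy defect, the correction and the corrected scheme by $$\mathcal E=\oint_{\partial K}\hat g_{\mathbf n}(V^h|_K,V^h|_{K^-})\,d\gamma-\sum_{\sigma\in K}\langle V_\sigma,\Phi_\sigma\rangle,\qquad r_\sigma=\frac{\mathcal E}{\sum_{\sigma'\in K}|V_{\sigma'}-\bar V|^2}\,(V_\sigma-\bar V),\qquad \Phi'_\sigma=\Phi_\sigma+r_\sigma,$$ where $\bar V$ is the arithmetic mean of the $V_\sigma$, $\sigma\in K$, and $r_\sigma=0$ if all $V_\sigma$ coincide. Then: 1. The corrected scheme is conservative and locally entropy conservative: on every cell $\sum_{\sigma\in K}\Phi'_\sigma=\Phi$ and, unless all $V_\sigma$, $\sigma\in K$, coincide, $$\sum_{\sigma\in K}\langle V_\sigma,\Phi'_\sigma\rangle=\oint_{\partial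 K}\hat g_{\mathbf n}(V^h|_K,V^h|_{K^-})\,d\gamma.$$ 2. $\mathcal E=O(h^{k+d+1})$ as $h\to0$, uniformly over all cells. 3. The correction does not degrade the accuracy: $\Phi_\sigma=O(h^{k+d})$ uniformly over all cells and, for every $\delta>0$, $r_\sigma=O(h^{k+d})$ and $\Phi'_\sigma=O(h^{k+d})$ uniformly over the cells with $\sum_{\sigma\in K}|V_\sigma-\bar V|^2\ge\delta h^2$. -/

import Mathlib

noncomputable section

namespace ResidualDistribution

/-- Euclidean space `ℝ^m`. -/
abbrev Sp (m : ℕ) := EuclideanSpace ℝ (Fin m)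

/-! ### Simplices of `ℝ^d`, `d = n + 1`, and integrals over their faces -/

/-- A nondegenerate `d`-simplex of `ℝ^d`, given by its `d + 1` vertices (they form an affine
basis, whose coordinates are the barycentric coordinates of the simplex). -/
abbrev Simplex (n : ℕ) := AffineBasis (Fin (n + 2)) ℝ (Sp (n + 1))

namespace Simplex

variable {n : ℕ}

/-- The closed simplex. -/
def carrier (K : Simplex n) : Set (Sp (n + 1)) := convexHull ℝ (Set.range K)

/-- The closed face opposite to the vertex `i`. -/
def face (K : Simplex n) (i : Fin (n + 2)) : Set (Sp (n + 1)) :=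
  convexHull ℝ (K '' {j | j ≠ i})

/-- The gradient of the `i`-th barycentric coordinate. -/
def gradCoord (K : Simplex n) (i : Fin (n + 2)) : Sp (n + 1) :=
  (InnerProductSpace.toDual ℝ (Sp (n + 1))).symm
    (LinearMap.toContinuousLinearMap (K.coord i).linear)

/-- The outward unit normal on the face opposite to the vertex `i`: the `i`-th barycentric
coordinate vanishes on that face and is positive inside the simplex. -/
def normal (K : Simplex n) (i : Fin (n + 2)) : Sp (n + 1) :=
  -(‖K.gradCoord i‖⁻¹ • K.gradCoord i)

/-- The vertices of the face opposite to the vertex `i`. -/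
def faceVertex (K : Simplex n) (i : Fin (n + 2)) (j : Fin (n + 1)) : Sp (n + 1) :=
  K (i.succAbove j)

/-- The edge vectors of the face opposite to the vertex `i`, from its first vertex. -/
def faceEdge (K : Simplex n) (i : Fin (n + 2)) (j : Fin n) : Sp (n + 1) :=
  K.faceVertex i j.succ - K.faceVertex i 0

/-- The affine parametrisation of the face by the reference simplex of `ℝ^(d-1)`. -/
def faceParam (K : Simplex n) (i : Fin (n + 2)) (t : Fin n → ℝ) : Sp (n + 1) :=
  K.faceVertex i 0 + ∑ j, t j • K.faceEdge i j

/-- The surface element `√(det (Gram matrix))` of the affine parametrisation. -/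
def faceJacobian (K : Simplex n) (i : Fin (n + 2)) : ℝ :=
  Real.sqrt (Matrix.det
    (Matrix.of fun j l : Fin n => inner ℝ (K.faceEdge i j) (K.faceEdge i l)))

end Simplex

/-- The reference simplex of `ℝ^n`. -/
def refSimplex (n : ℕ) : Set (Fin n → ℝ) := {t | (∀ j, 0 ≤ t j) ∧ ∑ j, t j ≤ 1}

namespace Simplex

variable {n : ℕ}

/-- The exact surface integral `∫_f ψ dγ` over the face opposite to the vertex `i`. -/
def faceIntegral (K : Simplex n) (i : Fin (n + 2)) (ψ : Sp (n + 1) → ℝ) : ℝ :=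
  K.faceJacobian i * ∫ t in refSimplex n, ψ (K.faceParam i t)

/-- The surface measure `|f|` of the face opposite to the vertex `i`. -/
def faceArea (K : Simplex n) (i : Fin (n + 2)) : ℝ := K.faceIntegral i fun _ => 1

/-- The exact flux `∫_{∂K} ψ · n dγ` of a vector field through the boundary of the simplex. -/
def boundaryFlux (K : Simplex n) (ψ : Sp (n + 1) → Sp (n + 1)) : ℝ :=
  ∑ i, K.faceIntegral i fun x => inner ℝ (ψ x) (K.normal i)

theorem inner_gradCoord (K : Simplex n) (i : Fin (n + 2)) (v : Sp (n + 1)) :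
    inner ℝ (K.gradCoord i) v = (K.coord i).linear v := by
  simp [gradCoord]

theorem inner_gradCoord_sub (K : Simplex n) (i j l : Fin (n + 2)) :
    inner ℝ (K.gradCoord i) (K j - K l) = K.coord i (K j) - K.coord i (K l) := by
  rw [inner_gradCoord, ← vsub_eq_sub, (K.coord i).linearMap_vsub, vsub_eq_sub]

theorem gradCoord_ne_zero (K : Simplex n) (i : Fin (n + 2)) : K.gradCoord i ≠ 0 := by
  intro h
  obtain ⟨j, hj⟩ := exists_ne i
  have := K.inner_gradCoord_sub i i j
  rw [h, inner_zero_left, K.coord_apply_eq, K.coord_apply_ne hj.symm] at this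
  norm_num at this

/-- The normal is a unit vector. -/
theorem norm_normal (K : Simplex n) (i : Fin (n + 2)) : ‖K.normal i‖ = 1 := by
  have := norm_ne_zero_iff.2 (K.gradCoord_ne_zero i)
  rw [normal, norm_neg, norm_smul, norm_inv, norm_norm, inv_mul_cancel₀ this]

/-- The normal is orthogonal to the face. -/
theorem inner_normal_face (K : Simplex n) (i j l : Fin (n + 2)) (hj : j ≠ i) (hl : l ≠ i) :
    inner ℝ (K.normal i) (K j - K l) = 0 := by
  rw [normal, inner_neg_left, real_inner_smul_left, inner_gradCoord_sub,
    K.coord_apply_ne hj.symm, K.coord_apply_ne hl.symm]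
  simp

/-- The normal points away from the opposite vertex. -/
theorem inner_normal_neg (K : Simplex n) (i j : Fin (n + 2)) (hj : j ≠ i) :
    inner ℝ (K.normal i) (K i - K j) < 0 := by
  have := norm_pos_iff.2 (K.gradCoord_ne_zero i)
  rw [normal, inner_neg_left, real_inner_smul_left, inner_gradCoord_sub,
    K.coord_apply_ne hj.symm, K.coord_apply_eq]
  simpa using this

end Simplex

/-! ### Conforming triangulations -/

/-- A conforming triangulation of `Ω ⊆ ℝ^d`, `d = n + 1`, by finitely many simplices. -/
structure Mesh (n : ℕ) (Ω : Set (Sp (n + 1))) where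
  Cell : Type
  finite : Finite Cell
  simplex : Cell → Simplex n
  cover : ⋃ c, (simplex c).carrier = closure Ω
  interior_subset : ∀ c, interior (simplex c).carrier ⊆ Ω
  disjoint_interior : ∀ c c', c ≠ c' →
    Disjoint (interior (simplex c).carrier) (interior (simplex c').carrier)
  conforming : ∀ c c', c ≠ c' → (simplex c).carrier ∩ (simplex c').carrier =
    convexHull ℝ (Set.range (simplex c) ∩ Set.range (simplex c'))

namespace Mesh

variable {n : ℕ} {Ω : Set (Sp (n + 1))}

/-- The mesh size `h`, the largest diameter of a cell. -/
def size (M : Mesh n Ω) : ℝ := ⨆ c, Metric.diam (M.simplex c).carrier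

open Classical in
/-- The cell `K⁻` on the other side of the face of `c` opposite to its vertex `i`; on a face
that no other cell shares (a face on `∂Ω`) it is `c` itself. -/
def across (M : Mesh n Ω) (c : M.Cell) (i : Fin (n + 2)) : M.Cell :=
  if h : ∃ c', c' ≠ c ∧ ∀ j, j ≠ i → M.simplex c j ∈ Set.range (M.simplex c') then h.choose
  else c

end Mesh

/-- `e = O(h^m)` uniformly over all cells of a family of meshes, as `h → 0`. -/
def IsBigOMesh {n : ℕ} {Ω : Set (Sp (n + 1))} {ι : Type*} (M : ι → Mesh n Ω)
    (e : ∀ a, (M a).Cell → ℝ) (m : ℕ) : Prop :=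
  ∃ C : ℝ, ∃ h₀ : ℝ, 0 < h₀ ∧ ∀ a, (M a).size ≤ h₀ → ∀ c, |e a c| ≤ C * (M a).size ^ m

/-! ### Quadrature on the element boundaries -/

/-- Weights and nodes of a quadrature formula `|f| ∑_q ω_q v(x_q)`. -/
structure FaceRule (n : ℕ) where
  card : ℕ
  weight : Fin card → ℝ
  node : Fin card → Sp (n + 1)

/-- A quadrature formula on each face of each cell, with nodes in the face. -/
structure BoundaryQuadrature {n : ℕ} {Ω : Set (Sp (n + 1))} (M : Mesh n Ω) where
  rule : M.Cell → Fin (n + 2) → FaceRule n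
  node_mem : ∀ c i q, (rule c i).node q ∈ (M.simplex c).face i

/-- The numerical integral `∮_{∂K} v dγ`; the integrand `v i x` may depend on the face `i`. -/
def BoundaryQuadrature.integral {n : ℕ} {Ω : Set (Sp (n + 1))} {M : Mesh n Ω}
    (Q : BoundaryQuadrature M) {F : Type*} [AddCommGroup F] [Module ℝ F] (c : M.Cell)
    (v : Fin (n + 2) → Sp (n + 1) → F) : F :=
  ∑ i, (M.simplex c).faceArea i •
    ∑ q, (Q.rule c i).weight q • v i ((Q.rule c i).node q)

/-- The quadrature weights of a family are uniformly bounded in `ℓ¹`. -/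
def BoundedWeights {n : ℕ} {Ω : Set (Sp (n + 1))} {ι : Type*} {M : ι → Mesh n Ω}
    (Q : ∀ a, BoundaryQuadrature (M a)) : Prop :=
  ∃ W : ℝ, ∀ a c i, ∑ q, |((Q a).rule c i).weight q| ≤ W

/-- The boundary quadrature is of order `k`: for every vector field `ψ` of class `C^{k+2}` on
the closure of `Ω`, `∮_{∂K} ψ · n dγ = ∫_{∂K} ψ · n dγ + O(h^{k+d+1})`, where `d = n + 1`. -/
def QuadratureOrder {n : ℕ} {Ω : Set (Sp (n + 1))} {ι : Type*} {M : ι → Mesh n Ω}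
    (Q : ∀ a, BoundaryQuadrature (M a)) (k : ℕ) : Prop :=
  ∀ ψ : Sp (n + 1) → Sp (n + 1), ContDiffOn ℝ (k + 2 : ℕ) ψ (closure Ω) →
    IsBigOMesh M (fun a c =>
      (Q a).integral c (fun i x => inner ℝ (ψ x) (((M a).simplex c).normal i)) -
        ((M a).simplex c).boundaryFlux ψ) (k + (n + 1) + 1)

/-! ### Systems of conservation laws with an entropy -/

/-- A system of `p` conservation laws `div f(u) = 0` in `ℝ^d`, `d = n + 1`, with states in the
open set `D`, together with an entropy `U` and entropy flux `g`, all of class `C^r`. -/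
structure EntropySystem (n p r : ℕ) where
  D : Set (Sp p)
  isOpen : IsOpen D
  f : Fin (n + 1) → Sp p → Sp p
  U : Sp p → ℝ
  g : Fin (n + 1) → Sp p → ℝ
  contDiff_f : ∀ j, ContDiffOn ℝ r (f j) D
  contDiff_U : ContDiffOn ℝ r U D
  contDiff_g : ∀ j, ContDiffOn ℝ r (g j) D
  convex_U : ConvexOn ℝ D U
  hessian_pos : ∀ u ∈ D, ∀ w, w ≠ 0 → 0 < inner ℝ w (fderiv ℝ (gradient U) u w)
  compatible : ∀ j, ∀ u ∈ D, ∀ w,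
    inner ℝ (gradient U u) (fderiv ℝ (f j) u w) = fderiv ℝ (g j) u w

namespace EntropySystem

variable {n p r : ℕ} (S : EntropySystem n p r)

/-- The entropy variable `V(u) = ∇U(u)`. -/
def entropyVar (u : Sp p) : Sp p := gradient S.U u

/-- The set of values of the entropy variable. -/
def entropyStates : Set (Sp p) := S.entropyVar '' S.D

/-- The conserved variable `u(V)`, inverse of `u ↦ V(u)` on `D`. -/
def consVar (v : Sp p) : Sp p := Function.invFunOn S.entropyVar S.D v

/-- The flux `f_j(V) = f_j(u(V))` as a function of the entropy variable. -/
def fluxV (j : Fin (n + 1)) (v : Sp p) : Sp p := S.f j (S.consVar v)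

/-- The normal flux `f(V) · ν`. -/
def normalFlux (ν : Sp (n + 1)) (v : Sp p) : Sp p := ∑ j, ν j • S.fluxV j v

/-- The potential `θ_j(V) = ⟨V, f_j(V)⟩ - g_j(V)`. -/
def potential (j : Fin (n + 1)) (v : Sp p) : ℝ :=
  inner ℝ v (S.fluxV j v) - S.g j (S.consVar v)

/-- `u` is a smooth steady solution on `Ω`: it is `C^r` up to the boundary, takes its values in
`D`, and satisfies `∑_j ∂_j (f_j(u)) = 0` at every point of `Ω`. -/
structure IsSmoothSteadySolution (Ω : Set (Sp (n + 1))) (u : Sp (n + 1) → Sp p) : Prop where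
  contDiff : ContDiffOn ℝ r u (closure Ω)
  mem : ∀ x ∈ closure Ω, u x ∈ S.D
  div_eq_zero : ∀ x ∈ Ω,
    ∑ j, fderiv ℝ (fun y => S.f j (u y)) x (EuclideanSpace.single j 1) = 0

/-- `fhat ν a b` is a numerical flux in the entropy variables: consistent with `f · ν`, and
Lipschitz continuous on compact sets of states, uniformly in the unit normal `ν`. -/
structure IsNumericalFlux (fhat : Sp (n + 1) → Sp p → Sp p → Sp p) : Prop where
  consistent : ∀ ν, ‖ν‖ = 1 → ∀ a ∈ S.entropyStates, fhat ν a a = S.normalFlux ν a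
  lipschitz : ∀ A ⊆ S.entropyStates, IsCompact A → ∃ L : ℝ, ∀ ν, ‖ν‖ = 1 →
    ∀ a ∈ A, ∀ b ∈ A, ∀ a' ∈ A, ∀ b' ∈ A,
      ‖fhat ν a b - fhat ν a' b'‖ ≤ L * (‖a - a'‖ + ‖b - b'‖)

/-- The numerical entropy flux `ĝ_ν(a, b) = ⟨{V}, f̂_ν(a, b)⟩ - θ({V}) · ν`, where
`{V} = (a + b) / 2`. -/
def entropyFlux (fhat : Sp (n + 1) → Sp p → Sp p → Sp p) (ν : Sp (n + 1)) (a b : Sp p) : ℝ :=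
  inner ℝ ((1 / 2 : ℝ) • (a + b)) (fhat ν a b) -
    ∑ j, ν j * S.potential j ((1 / 2 : ℝ) • (a + b))

end EntropySystem

/-! ### Finite elements and residual distribution schemes -/

/-- A finite element of degree `k` on the reference simplex of `ℝ^d`, `d = n + 1`, described by
its basis functions `φ_σ`, a basis of the polynomials of total degree at most `k` (the linear
forms of the element are the dual basis), which sum to one. -/
structure FiniteElement (n k : ℕ) (Dof : Type*) [Fintype Dof] where
  basis : Module.Basis Dof ℝ (MvPolynomial.restrictTotalDegree (Fin (n + 1)) ℝ k)
  sum_eq_one : ∑ σ, (basis σ : MvPolynomial (Fin (n + 1)) ℝ) = 1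

/-- The basis function `φ_σ` on the simplex `K`, transported by the affine map that sends the
reference simplex to `K`. -/
def FiniteElement.shape {n k : ℕ} {Dof : Type*} [Fintype Dof] (P : FiniteElement n k Dof)
    (K : Simplex n) (σ : Dof) (x : Sp (n + 1)) : ℝ :=
  MvPolynomial.eval (fun j : Fin (n + 1) => K.coord j.succ x)
    (P.basis σ : MvPolynomial (Fin (n + 1)) ℝ)

/-- The data of a residual distribution scheme `Φ_σ = β_σ Φ` on one mesh, with finite element
`P` and numerical flux `fhat`, at the piecewise polynomial state with degrees of freedom `V_σ`.
The matrices `β_σ` may depend in any way on the cell and on the state. -/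
structure RDScheme {n p k : ℕ} {Ω : Set (Sp (n + 1))} {Dof : Type*} [Fintype Dof]
    (P : FiniteElement n k Dof) (fhat : Sp (n + 1) → Sp p → Sp p → Sp p) (M : Mesh n Ω) where
  quad : BoundaryQuadrature M
  dofs : M.Cell → Dof → Sp p
  β : M.Cell → Dof → (Sp p →L[ℝ] Sp p)
  sum_β : ∀ c, ∑ σ, β c σ = ContinuousLinearMap.id ℝ (Sp p)

namespace RDScheme

variable {n p k r : ℕ} {Ω : Set (Sp (n + 1))} {M : Mesh n Ω} {Dof : Type*} [Fintype Dof]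
  {P : FiniteElement n k Dof} {fhat : Sp (n + 1) → Sp p → Sp p → Sp p} (R : RDScheme P fhat M)

/-- The discrete state `V^h` restricted to the cell `c`. -/
def state (c : M.Cell) (x : Sp (n + 1)) : Sp p :=
  ∑ σ, P.shape (M.simplex c) σ x • R.dofs c σ

/-- The total residual `Φ = ∮_{∂K} f̂_n(V^h|_K, V^h|_{K⁻}) dγ`. -/
def totalResidual (c : M.Cell) : Sp p :=
  R.quad.integral c fun i x =>
    fhat ((M.simplex c).normal i) (R.state c x) (R.state (M.across c i) x)

/-- The residuals `Φ_σ = β_σ Φ`. -/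
def residual (c : M.Cell) (σ : Dof) : Sp p := R.β c σ (R.totalResidual c)

/-- The numerical entropy balance `∮_{∂K} ĝ_n(V^h|_K, V^h|_{K⁻}) dγ`. -/
def entropyBalance (S : EntropySystem n p r) (c : M.Cell) : ℝ :=
  R.quad.integral c fun i x =>
    S.entropyFlux fhat ((M.simplex c).normal i) (R.state c x) (R.state (M.across c i) x)

/-- The entropy defect `𝓔 = ∮_{∂K} ĝ_n dγ - ∑_σ ⟨V_σ, Φ_σ⟩`. -/
def defect (S : EntropySystem n p r) (c : M.Cell) : ℝ :=
  R.entropyBalance S c - ∑ σ, inner ℝ (R.dofs c σ) (R.residual c σ)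

/-- The arithmetic mean of the `V_σ` on a cell. -/
def mean (c : M.Cell) : Sp p := (Fintype.card Dof : ℝ)⁻¹ • ∑ σ, R.dofs c σ

/-- `∑_σ |V_σ - V̄|²`. -/
def spread (c : M.Cell) : ℝ := ∑ σ, ‖R.dofs c σ - R.mean c‖ ^ 2

/-- The correction `r_σ = α (V_σ - V̄)`, `α = 𝓔 / ∑_σ |V_σ - V̄|²`. -/
def correction (S : EntropySystem n p r) (c : M.Cell) (σ : Dof) : Sp p :=
  (R.defect S c / R.spread c) • (R.dofs c σ - R.mean c)

/-- The corrected residuals `Φ'_σ = Φ_σ + r_σ`. -/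
def correctedResidual (S : EntropySystem n p r) (c : M.Cell) (σ : Dof) : Sp p :=
  R.residual c σ + R.correction S c σ

end RDScheme

end ResidualDistribution

end

open ResidualDistribution

/-! Part 1 is algebra: the differences V_σ - V̄ sum to zero, hence so do the corrections, and their
scaling makes ∑⟨V_σ, r_σ⟩ equal to 𝓔.

The estimates rest on the size of 𝓔. Let V₀ be the exact entropy variable at a vertex of K, and let
f, g be evaluated at the exact solution. Since ∑Φ_σ = Φ, one has (`RDScheme.defect_eq`) 𝓔 = ∮[(ĝ -
⟨V₀, f̂⟩) - (g - ⟨V₀, f⟩)·n] + ∮ g·n - ⟨V₀, ∮ f·n⟩ - ∑⟨V_σ - V₀, Φ_σ⟩. Along a smooth solution f(u)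
and g(u) are both divergence free, so the second and third terms are pure quadrature errors. In the
last sum V_σ - V₀ = O(h) and Φ_σ = O(h^{k+d}). The first integrand equals ⟨({V} - V) + (V - V₀), f̂
- f·n⟩ minus the first-order Taylor remainder of θ·n at V. The product is O(h)·O(h^{k+1}), and
because ∇θ_j = f_j (`hasFDerivAt_potential`) the remainder is O(h^{2k+2}); integrating over faces of
area O(h^{d-1}) gives O(h^{k+d+1}). Finally |r_σ| ≤ |𝓔| / √(∑|V_σ - V̄|²), so the correction loses
exactly one power of h on the nondegenerate cells.

Two tools support this. One is Gauss' theorem for divergence-free fields on a simplex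
(`Simplex.boundaryFlux_eq_zero`), proved in ordered coordinates 1 ≥ z_0 ≥ … ≥ 0, where each partial
derivative integrates to a difference over two consecutive facets. The other is the bound of degrees
of freedom by the sup norm, uniform over all simplices (`FiniteElement.exists_dof_bound`). Only
upper bounds on face areas enter, so no shape regularity is needed. -/

namespace ResidualDistribution

open MeasureTheory Set Topology

/-! ### Ordered coordinates on a simplex -/

section Kuhn

/-- The tuple `(1, z_0, …, z_{n-1}, 0)`. -/
noncomputable def extend {n : ℕ} (z : Fin n → ℝ) : Fin (n + 2) → ℝ :=
  Fin.cons 1 (Fin.snoc (α := fun _ => ℝ) z 0)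

variable {n : ℕ}

theorem extend_zero (z : Fin n → ℝ) : extend z 0 = 1 := rfl

theorem extend_last (z : Fin n → ℝ) : extend z (Fin.last (n + 1)) = 0 := by
  rw [extend, ← Fin.succ_last, Fin.cons_succ, Fin.snoc_last]

theorem extend_succ_castSucc (z : Fin n → ℝ) (j : Fin n) : extend z j.castSucc.succ = z j := by
  rw [extend, Fin.cons_succ, Fin.snoc_castSucc]

theorem extend_of_val (z : Fin n → ℝ) {i : Fin (n + 2)} {j : Fin n} (h : i.val = j.val + 1) :
    extend z i = z j := by
  rw [← extend_succ_castSucc z j]; congr 1; ext; simpa using h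

theorem continuous_extend (i : Fin (n + 2)) : Continuous fun z : Fin n → ℝ => extend z i := by
  refine Fin.cases continuous_const (fun i => ?_) i
  refine Fin.lastCases ?_ (fun j => ?_) i
  · simpa only [Fin.succ_last, extend_last] using continuous_const
  · simpa only [extend_succ_castSucc] using continuous_apply j

/-- The ordered simplex `1 ≥ z_0 ≥ … ≥ z_{n-1} ≥ 0`. -/
def kuhn (n : ℕ) : Set (Fin n → ℝ) :=
  {z | ∀ i : Fin (n + 1), extend z i.succ ≤ extend z i.castSucc}

theorem antitone_extend {z : Fin n → ℝ} (hz : z ∈ kuhn n) : Antitone (extend z) :=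
  Fin.antitone_iff_succ_le.2 hz

theorem isClosed_kuhn : IsClosed (kuhn n) := by
  simp only [kuhn, ofPred_forall]
  exact isClosed_iInter fun i => isClosed_le (continuous_extend _) (continuous_extend _)

theorem isCompact_kuhn : IsCompact (kuhn n) := by
  refine (isCompact_univ_pi fun _ : Fin n =>
    isCompact_Icc (a := (0 : ℝ)) (b := 1)).of_isClosed_subset isClosed_kuhn fun z hz j _ => ?_
  rw [← extend_succ_castSucc z j]
  exact ⟨(extend_last z).symm.le.trans (antitone_extend hz (Fin.le_last _)),
    (antitone_extend hz (Fin.zero_le _)).trans (extend_zero z).le⟩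

/-- The point of the ordered simplex of dimension `n + 1` obtained by repeating the `i`-th entry
of `(1, z_0, …, z_{n-1}, 0)`. -/
noncomputable def degen (i : Fin (n + 2)) (z : Fin n → ℝ) : Fin (n + 1) → ℝ :=
  fun j => extend z (i.predAbove j.castSucc.succ)

theorem extend_degen (i : Fin (n + 2)) (z : Fin n → ℝ) (l : Fin (n + 3)) :
    extend (degen i z) l = extend z (i.predAbove l) := by
  refine Fin.cases ?_ (fun l => ?_) l
  · rw [extend_zero, Fin.predAbove_right_zero, extend_zero]
  refine Fin.lastCases ?_ (fun j => ?_) l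
  · rw [Fin.succ_last, extend_last, Fin.predAbove_right_last, extend_last]
  · rw [extend_succ_castSucc, degen]

theorem degen_mem_kuhn (i : Fin (n + 2)) {z : Fin n → ℝ} (hz : z ∈ kuhn n) :
    degen i z ∈ kuhn (n + 1) := fun l => by
  rw [extend_degen, extend_degen]
  exact antitone_extend hz (Fin.predAbove_right_monotone i (Fin.castSucc_le_succ l))

theorem continuous_degen (i : Fin (n + 2)) : Continuous (degen i : (Fin n → ℝ) → _) :=
  continuous_pi fun _ => continuous_extend _

/-- At an end of its admissible range the inserted entry coincides with a neighbour: the upper end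
gives the facet `m.castSucc`, the lower end the facet `m.succ`. -/
theorem insertNth_castSucc (m : Fin (n + 1)) (z : Fin n → ℝ) :
    m.insertNth (α := fun _ => ℝ) (extend z m.castSucc) z = degen m.castSucc z := by
  funext l
  refine Fin.succAboveCases m ?_ (fun j => ?_) l
  · rw [Fin.insertNth_apply_same, degen]
    congr 1
    ext; simp [Fin.predAbove]
  · rw [Fin.insertNth_apply_succAbove, degen]
    refine (extend_of_val z ?_).symm
    rcases lt_or_ge j.castSucc m with h | h
    · rw [Fin.succAbove_of_castSucc_lt _ _ h, Fin.predAbove, dif_neg]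
      · simp
      · simp only [Fin.lt_def, Fin.val_succ, Fin.val_castSucc] at h ⊢; omega
    · rw [Fin.succAbove_of_le_castSucc _ _ h, Fin.predAbove, dif_pos]
      · simp
      · simp only [Fin.le_def, Fin.lt_def, Fin.val_succ, Fin.val_castSucc] at h ⊢; omega

theorem insertNth_succ (m : Fin (n + 1)) (z : Fin n → ℝ) :
    m.insertNth (α := fun _ => ℝ) (extend z m.succ) z = degen m.succ z := by
  funext l
  refine Fin.succAboveCases m ?_ (fun j => ?_) l
  · rw [Fin.insertNth_apply_same, degen]
    congr 1
    ext; simp [Fin.predAbove]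
  · rw [Fin.insertNth_apply_succAbove, degen]
    refine (extend_of_val z ?_).symm
    rcases lt_or_ge j.castSucc m with h | h
    · rw [Fin.succAbove_of_castSucc_lt _ _ h, Fin.predAbove, dif_neg]
      · simp
      · simp only [Fin.lt_def, Fin.val_succ, Fin.val_castSucc] at h ⊢; omega
    · rw [Fin.succAbove_of_le_castSucc _ _ h, Fin.predAbove, dif_pos]
      · simp
      · simp only [Fin.le_def, Fin.lt_def, Fin.val_succ, Fin.val_castSucc] at h ⊢; omega

theorem extend_insertNth (m : Fin (n + 1)) (x : ℝ) (z : Fin n → ℝ) :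
    extend (m.insertNth (α := fun _ => ℝ) x z) =
      m.castSucc.succ.insertNth (α := fun _ => ℝ) x (extend z) := by
  funext l
  refine Fin.cases ?_ (fun l => ?_) l
  · have : (0 : Fin (n + 3)) = m.castSucc.succ.succAbove 0 := by simp
    rw [extend_zero, this, Fin.insertNth_apply_succAbove, extend_zero]
  refine Fin.lastCases ?_ (fun j => ?_) l
  · have : (Fin.last (n + 2)) = m.castSucc.succ.succAbove (Fin.last _) := by
      rw [Fin.succAbove_of_le_castSucc _ _ (by simp [Fin.le_def]; omega), Fin.succ_last]
    rw [Fin.succ_last, extend_last, this, Fin.insertNth_apply_succAbove, extend_last]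
  · rw [extend_succ_castSucc]
    refine Fin.succAboveCases m ?_ (fun i => ?_) j
    · rw [Fin.insertNth_apply_same, Fin.insertNth_apply_same]
    · have : (m.succAbove i).castSucc.succ = m.castSucc.succ.succAbove i.castSucc.succ := by
        simp
      rw [Fin.insertNth_apply_succAbove, this, Fin.insertNth_apply_succAbove,
        extend_succ_castSucc]

/-- The slices needed for Fubini: the only inequalities that involve the new entry are those with
its two neighbours. -/
theorem insertNth_mem_kuhn_iff (m : Fin (n + 1)) (x : ℝ) (z : Fin n → ℝ) :
    m.insertNth (α := fun _ => ℝ) x z ∈ kuhn (n + 1) ↔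
      z ∈ kuhn n ∧ x ∈ Icc (extend z m.succ) (extend z m.castSucc) := by
  have hx : extend (m.insertNth (α := fun _ => ℝ) x z) m.castSucc.succ = x := by
    rw [extend_succ_castSucc, Fin.insertNth_apply_same]
  have ho : ∀ j, extend (m.insertNth (α := fun _ => ℝ) x z) (m.castSucc.succ.succAbove j) =
      extend z j := fun j => by
    rw [extend_insertNth, Fin.insertNth_apply_succAbove]
  have h1 : m.castSucc.succ.succAbove m.castSucc = m.castSucc.castSucc :=
    Fin.succAbove_of_castSucc_lt _ _ (by simp [Fin.lt_def])
  have h2 : m.castSucc.succ.succAbove m.succ = m.succ.succ :=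
    Fin.succAbove_of_le_castSucc _ _ (by simp)
  constructor
  · intro h
    have ha := antitone_extend h
    refine ⟨fun i => ?_, ?_, ?_⟩
    · rw [← ho, ← ho]
      exact ha ((Fin.strictMono_succAbove _).monotone (Fin.castSucc_le_succ i))
    · rw [← ho, h2]; refine le_of_le_of_eq (ha ?_) hx
      simpa using Fin.castSucc_le_succ m
    · rw [← ho, h1]; refine le_of_eq_of_le hx.symm (ha ?_)
      simp [Fin.le_def]
  · rintro ⟨hz, hx1, hx2⟩
    have ha := antitone_extend hz
    intro i
    by_cases c1 : i.castSucc = m.castSucc.succ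
    · have e : i.succ = m.castSucc.succ.succAbove m.succ := by
        rw [h2]; ext; simpa using congrArg Fin.val c1
      rw [c1, hx, e, ho]
      exact hx1
    by_cases c2 : i.succ = m.castSucc.succ
    · have e : i.castSucc = m.castSucc.succ.succAbove m.castSucc := by
        rw [h1]; ext; simpa using congrArg Fin.val c2
      rw [c2, hx, e, ho]
      exact hx2
    -- Both indices now carry old entries, so monotonicity of `extend z` decides.
    obtain ⟨j, hj⟩ := Fin.exists_succAbove_eq c1
    obtain ⟨l, hl⟩ := Fin.exists_succAbove_eq c2
    rw [← hj, ← hl, ho, ho]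
    refine ha ((Fin.strictMono_succAbove m.castSucc.succ).le_iff_le.1 ?_)
    rw [hj, hl]
    exact Fin.castSucc_le_succ i

/-! ### The divergence theorem in ordered coordinates -/

theorem setIntegral_kuhn_succ (m : Fin (n + 1)) {D : (Fin (n + 1) → ℝ) → ℝ}
    (hD : ContinuousOn D (kuhn (n + 1))) :
    ∫ y in kuhn (n + 1), D y = ∫ z in kuhn n,
      ∫ x in Icc (extend z m.succ) (extend z m.castSucc),
        D (m.insertNth (α := fun _ => ℝ) x z) := by
  have hint : IntegrableOn D (kuhn (n + 1)) := hD.integrableOn_compact isCompact_kuhn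
  have hms : MeasurableSet (kuhn (n + 1)) := isClosed_kuhn.measurableSet
  have hmp := (volume_preserving_piFinSuccAbove (fun _ : Fin (n + 1) => ℝ) m).symm
  rw [← integral_indicator hms, ← hmp.integral_comp', Measure.volume_eq_prod,
    integral_prod_symm]
  · rw [← integral_indicator isClosed_kuhn.measurableSet]
    congr 1
    funext z
    by_cases hz : z ∈ kuhn n
    · rw [indicator_of_mem hz, ← integral_indicator measurableSet_Icc]
      congr 1
      funext x
      have : (MeasurableEquiv.piFinSuccAbove (fun _ : Fin (n + 1) => ℝ) m).symm (x, z) =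
        m.insertNth (α := fun _ => ℝ) x z := rfl
      rw [this]
      simp only [indicator, insertNth_mem_kuhn_iff, hz, true_and]
    · rw [indicator_of_notMem hz]
      refine (integral_congr_ae (.of_forall fun x => ?_)).trans (integral_zero _ _)
      exact indicator_of_notMem (fun h => hz ((insertNth_mem_kuhn_iff m x z).1 h).1) _
  · rw [← Measure.volume_eq_prod]
    exact (hmp.integrable_comp_emb (MeasurableEquiv.measurableEmbedding _)).2
      ((integrable_indicator_iff hms).2 hint)

/-- Fubini in the `m`-th coordinate, then the fundamental theorem of calculus on each slice, whose
two ends lie on consecutive facets. -/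
theorem setIntegral_kuhn_deriv (m : Fin (n + 1)) {g : (Fin (n + 1) → ℝ) → ℝ}
    {g' : (Fin (n + 1) → ℝ) → (Fin (n + 1) → ℝ) →L[ℝ] ℝ}
    (hg : ∀ y ∈ kuhn (n + 1), HasFDerivWithinAt g (g' y) (kuhn (n + 1)) y)
    (hg' : ContinuousOn g' (kuhn (n + 1))) :
    ∫ y in kuhn (n + 1), g' y (Pi.single m 1) =
      ∫ z in kuhn n, (g (degen m.castSucc z) - g (degen m.succ z)) := by
  rw [setIntegral_kuhn_succ m (hg'.clm_apply continuousOn_const)]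
  refine setIntegral_congr_fun isClosed_kuhn.measurableSet fun z hz => ?_
  have hle : extend z m.succ ≤ extend z m.castSucc := hz m
  have hmaps : MapsTo (fun x => m.insertNth (α := fun _ => ℝ) x z)
      (Icc (extend z m.succ) (extend z m.castSucc)) (kuhn (n + 1)) :=
    fun x hx => (insertNth_mem_kuhn_iff m x z).2 ⟨hz, hx⟩
  have hline : ∀ x, HasDerivAt (fun x => m.insertNth (α := fun _ => ℝ) x z)
      (Pi.single m (1 : ℝ)) x := fun x => by
    rw [hasDerivAt_pi]
    intro l
    refine Fin.succAboveCases m ?_ (fun j => ?_) l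
    · simpa using hasDerivAt_id' x
    · simpa [Fin.succAbove_ne] using hasDerivAt_const x (z j)
  have hd : ∀ x ∈ Icc (extend z m.succ) (extend z m.castSucc),
      HasDerivWithinAt (fun x => g (m.insertNth (α := fun _ => ℝ) x z))
        (g' (m.insertNth (α := fun _ => ℝ) x z) (Pi.single m 1))
        (Icc (extend z m.succ) (extend z m.castSucc)) x := fun x hx =>
    (hg _ (hmaps hx)).comp_hasDerivWithinAt x (hline x).hasDerivWithinAt hmaps
  have hcl : Continuous fun x => m.insertNth (α := fun _ => ℝ) x z :=
    continuous_iff_continuousAt.2 fun x => (hline x).continuousAt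
  have hc : ContinuousOn (fun x => g' (m.insertNth (α := fun _ => ℝ) x z) (Pi.single m 1))
      (Icc (extend z m.succ) (extend z m.castSucc)) :=
    (hg'.comp hcl.continuousOn hmaps).clm_apply continuousOn_const
  rw [integral_Icc_eq_integral_Ioc, ← intervalIntegral.integral_of_le hle,
    intervalIntegral.integral_eq_sub_of_hasDerivAt_of_le hle
      (fun x hx => (hd x hx).continuousWithinAt)
      (fun x hx => (hd x (Ioo_subset_Icc_self hx)).hasDerivAt (Icc_mem_nhds hx.1 hx.2))
      (hc.intervalIntegrable_of_Icc hle), insertNth_castSucc, insertNth_succ]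

/-! ### Points of a simplex in ordered coordinates -/

variable {E : Type*} [AddCommGroup E] [Module ℝ E]

/-- The point with barycentric coordinates `1 - z_0, z_0 - z_1, …, z_{n-1}`. -/
noncomputable def point (F : Fin (n + 1) → E) (z : Fin n → ℝ) : E :=
  ∑ i : Fin (n + 1), (extend z i.castSucc - extend z i.succ) • F i

/-- Repeating the `i`-th entry makes the `i`-th barycentric coordinate zero, so `degen i`
parametrises the face opposite to the vertex `i`. -/
theorem point_degen (F : Fin (n + 2) → E) (i : Fin (n + 2)) (z : Fin n → ℝ) :
    point F (degen i z) = point (F ∘ i.succAbove) z := by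
  rw [point, Fin.sum_univ_succAbove _ i, point]
  simp only [extend_degen]
  have h0 : i.predAbove i.castSucc = i.predAbove i.succ := by
    rw [Fin.predAbove_castSucc_self, Fin.predAbove_succ_self]
  rw [h0, sub_self, zero_smul, zero_add]
  refine Finset.sum_congr rfl fun j _ => ?_
  have h1 : i.predAbove (i.succAbove j).castSucc = j.castSucc := by
    rcases lt_or_ge j.castSucc i with h | h
    · rw [Fin.succAbove_of_castSucc_lt _ _ h, Fin.predAbove, dif_neg]
      · ext; simp
      · simp only [Fin.lt_def, Fin.val_castSucc] at h ⊢; omega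
    · rw [Fin.succAbove_of_le_castSucc _ _ h, Fin.predAbove, dif_pos]
      · ext; simp
      · simp only [Fin.le_def, Fin.lt_def, Fin.val_succ, Fin.val_castSucc] at h ⊢; omega
  have h2 : i.predAbove (i.succAbove j).succ = j.succ := by
    rcases lt_or_ge j.castSucc i with h | h
    · rw [Fin.succAbove_of_castSucc_lt _ _ h, Fin.predAbove, dif_neg]
      · ext; simp
      · simp only [Fin.lt_def, Fin.val_succ, Fin.val_castSucc] at h ⊢; omega
    · rw [Fin.succAbove_of_le_castSucc _ _ h, Fin.predAbove, dif_pos]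
      · ext; simp
      · simp only [Fin.le_def, Fin.lt_def, Fin.val_succ, Fin.val_castSucc] at h ⊢; omega
  rw [h1, h2, Function.comp]

/-- Abel summation. The partial derivatives of `point` are thus the consecutive edges of the
simplex. -/
theorem point_eq (F : Fin (n + 1) → E) (z : Fin n → ℝ) :
    point F z = F 0 + ∑ m : Fin n, z m • (F m.succ - F m.castSucc) := by
  simp only [point, sub_smul, Finset.sum_sub_distrib, smul_sub]
  rw [Fin.sum_univ_succ (fun i : Fin (n + 1) => extend z i.castSucc • F i),
    Fin.sum_univ_castSucc (fun i : Fin (n + 1) => extend z i.succ • F i)]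
  simp only [Fin.succ_last, extend_last, Fin.castSucc_zero, extend_zero, ← Fin.succ_castSucc,
    extend_succ_castSucc]
  simp
  abel

theorem sum_extend_sub (z : Fin n → ℝ) :
    ∑ i : Fin (n + 1), (extend z i.castSucc - extend z i.succ) = 1 := by
  simpa [point] using point_eq (fun _ => (1 : ℝ)) z

/-- The barycentric coordinates with nonzero index, as functions of the ordered coordinates. -/
noncomputable def kuhnToRef (n : ℕ) : (Fin n → ℝ) →ₗ[ℝ] (Fin n → ℝ) where
  toFun z j := extend z j.castSucc.succ - extend z j.succ.succ
  map_add' z w := by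
    funext j
    simp only [extend, Fin.cons_succ, Pi.add_apply]
    have : ∀ i : Fin (n + 1), (Fin.snoc (α := fun _ => ℝ) (z + w) 0 : Fin (n + 1) → ℝ) i =
        (Fin.snoc (α := fun _ => ℝ) z 0 : Fin (n + 1) → ℝ) i +
        (Fin.snoc (α := fun _ => ℝ) w 0 : Fin (n + 1) → ℝ) i :=
      fun i => Fin.lastCases (by simp) (by simp) i
    rw [this, this]; ring
  map_smul' c z := by
    funext j
    simp only [extend, Fin.cons_succ, Pi.smul_apply, smul_eq_mul, RingHom.id_apply]
    have : ∀ i : Fin (n + 1), (Fin.snoc (α := fun _ => ℝ) (c • z) 0 : Fin (n + 1) → ℝ) i =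
        c * (Fin.snoc (α := fun _ => ℝ) z 0 : Fin (n + 1) → ℝ) i :=
      fun i => Fin.lastCases (by simp) (by simp) i
    rw [this, this]; ring

theorem kuhnToRef_apply (z : Fin n → ℝ) (j : Fin n) :
    kuhnToRef n z j = extend z j.castSucc.succ - extend z j.succ.succ := rfl

theorem sum_kuhnToRef (z : Fin n → ℝ) :
    ∑ j, kuhnToRef n z j = 1 - (extend z (Fin.castSucc 0) - extend z (Fin.succ 0)) := by
  rw [← sum_extend_sub z, Fin.sum_univ_succ]
  simp [kuhnToRef_apply]

theorem point_eq_ref (F : Fin (n + 1) → E) (z : Fin n → ℝ) :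
    point F z = F 0 + ∑ j, kuhnToRef n z j • (F j.succ - F 0) := by
  simp only [smul_sub, Finset.sum_sub_distrib, ← Finset.sum_smul, sum_kuhnToRef]
  rw [point, Fin.sum_univ_succ]
  simp only [kuhnToRef_apply, Fin.castSucc_succ, sub_smul, one_smul]
  abel

theorem kuhnToRef_mem_iff (z : Fin n → ℝ) : kuhnToRef n z ∈ refSimplex n ↔ z ∈ kuhn n := by
  simp only [refSimplex, kuhn, mem_ofPred_eq, sum_kuhnToRef, Fin.forall_fin_succ,
    Fin.castSucc_succ]
  simp only [kuhnToRef_apply]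
  constructor
  · rintro ⟨h1, h2⟩; exact ⟨by linarith, fun j => by linarith [h1 j]⟩
  · rintro ⟨h1, h2⟩; exact ⟨fun j => by linarith [h2 j], by linarith⟩

/-- The map is triangular: the entries are recovered by back substitution from the final 0. -/
theorem kuhnToRef_injective : Function.Injective (kuhnToRef n) := by
  rw [injective_iff_map_eq_zero]
  intro z hz
  have key : ∀ i : Fin (n + 1), extend z i.succ = 0 := by
    intro i
    refine Fin.reverseInduction ?_ (fun j hj => ?_) i
    · rw [Fin.succ_last, extend_last]
    · have := congrFun hz j
      rw [kuhnToRef_apply, hj, sub_zero] at this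
      exact this
  funext j
  rw [← extend_succ_castSucc z j, key]; rfl

/-- Linear change of variables. The value of the constant does not matter, being a common factor of
face integrals whose sum will be shown to vanish. -/
theorem exists_setIntegral_refSimplex (n : ℕ) : ∃ c : ℝ, ∀ F : (Fin n → ℝ) → ℝ,
    ∫ t in refSimplex n, F t = c * ∫ z in kuhn n, F (kuhnToRef n z) := by
  have hdet : LinearMap.det (kuhnToRef n) ≠ 0 := by
    have := (LinearEquiv.ofInjectiveEndo _ (kuhnToRef_injective (n := n))).isUnit_det'
    exact this.ne_zero
  have hmap := Measure.map_linearMap_addHaar_eq_smul_addHaar (volume : Measure (Fin n → ℝ)) hdet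
  refine ⟨|(LinearMap.det (kuhnToRef n))|, fun F => ?_⟩
  have hemb : MeasurableEmbedding (kuhnToRef n) :=
    ((kuhnToRef n).isClosedEmbedding_of_injective
      (LinearMap.ker_eq_bot.2 kuhnToRef_injective)).measurableEmbedding
  have h := hemb.setIntegral_map (μ := volume) F (refSimplex n)
  rw [hmap, Measure.restrict_smul, integral_smul_measure,
    ENNReal.toReal_ofReal (abs_nonneg _), abs_inv, smul_eq_mul] at h
  have hpre : kuhnToRef n ⁻¹' refSimplex n = kuhn n := ext kuhnToRef_mem_iff
  rw [hpre] at h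
  rw [← h, mul_inv_cancel_left₀ (abs_ne_zero.2 hdet)]

end Kuhn

/-! ### Surface elements of a simplex -/

namespace Simplex

variable {n : ℕ} (K : Simplex n)

theorem coord_linear_sub (i j l : Fin (n + 2)) :
    (K.coord i).linear (K j - K l) = (if i = j then 1 else 0) - (if i = l then 1 else 0) := by
  rw [← K.inner_gradCoord, inner_gradCoord_sub, K.coord_apply, K.coord_apply]

theorem linearIndependent_faceEdge (i : Fin (n + 2)) : LinearIndependent ℝ (K.faceEdge i) := by
  have h := K.ind.comp_embedding i.succAboveEmb
  rw [affineIndependent_iff_linearIndependent_vsub ℝ _ (0 : Fin (n + 1))] at h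
  exact h.comp (fun j : Fin n => ⟨j.succ, Fin.succ_ne_zero j⟩)
    fun a b hab => Fin.succ_injective _ (congrArg Subtype.val hab)

theorem det_inner_eq_mul {m : ℕ} (v w : Fin m → Sp m) :
    (Matrix.of fun r s => inner ℝ (v r) (w s)).det =
      (Matrix.of fun r l => v r l).det * (Matrix.of fun r l => w r l).det := by
  rw [← Matrix.det_transpose (Matrix.of fun r l => w r l), ← Matrix.det_mul]
  congr 1
  ext r s
  simp [Matrix.mul_apply, PiLp.inner_apply, mul_comm]

theorem det_of_column_zero {m : ℕ} (A : Matrix (Fin (m + 1)) (Fin (m + 1)) ℝ)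
    (h : ∀ j : Fin m, A j.succ 0 = 0) : A.det = A 0 0 * (A.submatrix Fin.succ Fin.succ).det := by
  rw [Matrix.det_succ_column_zero, Fin.sum_univ_succ]
  simp [h]

/-- The absolute value of the determinant of the edge vectors, `d!` times the volume. -/
noncomputable def edgeDet : ℝ :=
  |(Matrix.of fun (i : Fin (n + 2)) (l : Fin (n + 2)) =>
    (Fin.cons 1 (fun l => K i l) : Fin (n + 2) → ℝ) l).det|

/-- The edge vectors of the face opposite to `i`, preceded by the vector from the face to the
vertex `i`. -/
noncomputable def edges (i : Fin (n + 2)) : Fin (n + 1) → Sp (n + 1) :=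
  Fin.cons (K i - K.faceVertex i 0) (K.faceEdge i)

/-- Independence of `i` is the point: all faces share this factor. Row operations on the matrix of
vertices bordered by a column of ones give it. -/
theorem abs_det_edges (i : Fin (n + 2)) :
    |(Matrix.of fun r l => K.edges i r l).det| = K.edgeDet := by
  set A : Matrix (Fin (n + 2)) (Fin (n + 2)) ℝ := Matrix.of fun i l =>
    (Fin.cons 1 (fun l => K i l) : Fin (n + 2) → ℝ) l with hA
  have h1 : |(A.submatrix i.cycleRange.symm id).det| = K.edgeDet := by
    rw [Matrix.det_permute, abs_mul, edgeDet]
    rcases Int.units_eq_one_or (Equiv.Perm.sign i.cycleRange.symm) with h | h <;> simp [h, hA]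
  set A' := A.submatrix i.cycleRange.symm id with hA'
  -- After the cycle, row 0 is the vertex `i` and row 1 the first vertex of the face. Subtracting
  -- row 1 from the others produces the edges and leaves a single 1 in the column of ones.
  set A'' : Matrix (Fin (n + 2)) (Fin (n + 2)) ℝ := Matrix.of fun r l =>
    A' r l + (if r = 1 then 0 else -1) * A' 1 l with hA''
  have h2 : A''.det = A'.det :=
    Matrix.det_eq_of_forall_row_eq_smul_add_const (fun r => if r = 1 then 0 else -1) 1 (by simp)
      fun _ _ => rfl
  have hone : ∀ r, A' r 0 = 1 := fun r => rfl
  have h0 : (i.cycleRange.symm 0) = i := Fin.cycleRange_symm_zero i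
  have hs : ∀ j : Fin (n + 1), (i.cycleRange.symm j.succ) = i.succAbove j :=
    Fin.cycleRange_symm_succ i
  have h3 : A''.det = - (Matrix.of fun r l => K.edges i r l).det := by
    rw [Matrix.det_succ_column_zero, Finset.sum_eq_single 1]
    · have : A''.submatrix (Fin.succAbove 1) Fin.succ = Matrix.of fun r l => K.edges i r l := by
        ext r l
        have e1 : (1 : Fin (n + 2)) = Fin.succ 0 := rfl
        refine Fin.cases ?_ (fun j => ?_) r
        · simp only [Matrix.submatrix_apply, hA'', hA', hA, Matrix.of_apply, e1, h0, hs,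
            Fin.succ_succAbove_zero, id, Fin.cons_succ, edges, Fin.cons_zero]
          simp [faceVertex]
          ring
        · simp only [Matrix.submatrix_apply, hA'', hA', hA, Matrix.of_apply, e1, hs,
            Fin.succ_succAbove_succ, Fin.zero_succAbove, id, Fin.cons_succ, edges,
            Fin.succ_inj, Fin.succ_ne_zero, if_false]
          simp [faceVertex, faceEdge]
          ring
      rw [this]
      simp [hA'', hone]
    · intro r _ hr
      simp [hA'', hone, hr]
    · simp
  rw [← h1, ← h2, h3, abs_neg]

/-- Hence surface element times normal is `-edgeDet • gradCoord i`. With G the Gram determinant of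
the face edges, replace the transversal edge by the gradient, which is orthogonal to the face. If a
and y are the determinants before and after, then G = a y and |∇λ_i|² G = y², so that G = (a
|∇λ_i|)². -/
theorem faceJacobian_eq (i : Fin (n + 2)) :
    K.faceJacobian i = K.edgeDet * ‖K.gradCoord i‖ := by
  set G := (Matrix.of fun j l : Fin n => inner ℝ (K.faceEdge i j) (K.faceEdge i l)).det with hG
  have hGpos : 0 < G := (Matrix.posDef_gram_of_linearIndependent
    (K.linearIndependent_faceEdge i)).det_pos
  have hort : ∀ j, inner ℝ (K.faceEdge i j) (K.gradCoord i) = 0 := fun j => by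
    rw [real_inner_comm, faceEdge, faceVertex, faceVertex, inner_gradCoord, coord_linear_sub,
      if_neg (Fin.succAbove_ne _ _).symm, if_neg (Fin.succAbove_ne _ _).symm, sub_self]
  have hone : inner ℝ (K i - K.faceVertex i 0) (K.gradCoord i) = 1 := by
    rw [real_inner_comm, faceVertex, inner_gradCoord, coord_linear_sub, if_pos rfl,
      if_neg (Fin.succAbove_ne _ _).symm, sub_zero]
  let Y : Fin (n + 1) → Sp (n + 1) := Fin.cons (K.gradCoord i) (K.faceEdge i)
  have h1 := det_inner_eq_mul (K.edges i) Y
  have h2 := det_inner_eq_mul Y Y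
  rw [det_of_column_zero _ (fun j => by simpa [Y, edges] using hort j)] at h1
  rw [det_of_column_zero _ (fun j => by simpa [Y] using hort j)] at h2
  have e1 : (Matrix.of fun r s => inner ℝ (K.edges i r) (Y s)).submatrix Fin.succ Fin.succ =
      Matrix.of fun j l : Fin n => inner ℝ (K.faceEdge i j) (K.faceEdge i l) := by
    ext j l; simp [edges, Y]
  have e2 : (Matrix.of fun r s => inner ℝ (Y r) (Y s)).submatrix Fin.succ Fin.succ =
      Matrix.of fun j l : Fin n => inner ℝ (K.faceEdge i j) (K.faceEdge i l) := by
    ext j l; simp [Y]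
  rw [e1, ← hG] at h1
  rw [e2, ← hG] at h2
  simp only [Matrix.of_apply, edges, Y, Fin.cons_zero, hone, one_mul,
    real_inner_self_eq_norm_sq] at h1 h2
  have habs := K.abs_det_edges i
  simp only [edges] at habs
  set a := (Matrix.of fun (r l : Fin (n + 1)) =>
    (Fin.cons (K i - K.faceVertex i 0) (K.faceEdge i) : Fin (n + 1) → Sp (n + 1)) r l).det
  set y := (Matrix.of fun (r l : Fin (n + 1)) =>
    (Fin.cons (K.gradCoord i) (K.faceEdge i) : Fin (n + 1) → Sp (n + 1)) r l).det
  have hkey : G = (a * ‖K.gradCoord i‖) ^ 2 := by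
    refine mul_right_cancel₀ hGpos.ne' ?_
    calc G * G = (a * y) * (a * y) := by rw [h1]
      _ = a ^ 2 * (y * y) := by ring
      _ = _ := by rw [← h2]; ring
  rw [faceJacobian, ← hG, hkey, Real.sqrt_sq_eq_abs, abs_mul, abs_norm, habs]

/-! ### The divergence theorem on a simplex -/

theorem faceParam_kuhnToRef (i : Fin (n + 2)) (z : Fin n → ℝ) :
    K.faceParam i (kuhnToRef n z) = point K (degen i z) := by
  rw [point_degen, point_eq_ref]; rfl

theorem point_mem_carrier {y : Fin (n + 1) → ℝ} (hy : y ∈ kuhn (n + 1)) :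
    point K y ∈ K.carrier :=
  (convex_convexHull ℝ _).sum_mem (fun i _ => sub_nonneg.2 (hy i)) (sum_extend_sub y)
    fun i _ => subset_convexHull ℝ _ (mem_range_self i)

/-- The consecutive edge vectors of a simplex. -/
noncomputable def pathBasis : Module.Basis (Fin (n + 1)) ℝ (Sp (n + 1)) :=
  basisOfTopLeSpanOfCardEqFinrank (fun m : Fin (n + 1) => K m.succ - K m.castSucc) (by
    rw [← (K.basisOf 0).span_eq, Submodule.span_le]
    rintro _ ⟨j, rfl⟩
    rw [AffineBasis.basisOf_apply, vsub_eq_sub]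
    induction j.1 using Fin.induction with
    | zero => simp
    | succ m hm =>
      rw [← sub_add_sub_cancel _ (K m.castSucc)]
      exact add_mem (Submodule.subset_span ⟨m, rfl⟩) hm) (by simp)

theorem pathBasis_apply (m : Fin (n + 1)) : K.pathBasis m = K m.succ - K m.castSucc := by
  simp [pathBasis]

theorem continuous_point : Continuous (point K) := by
  unfold point
  exact continuous_finsetSum _ fun i _ =>
    ((continuous_extend _).sub (continuous_extend _)).smul continuous_const

theorem convex_carrier : Convex ℝ K.carrier := convex_convexHull ℝ _

theorem isCompact_carrier : IsCompact K.carrier := (finite_range K).isCompact_convexHull ℝ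

theorem nonempty_interior_carrier : (interior K.carrier).Nonempty := by
  rw [carrier, interior_convexHull_nonempty_iff_affineSpan_eq_top]; exact K.tot

theorem uniqueDiffOn_carrier : UniqueDiffOn ℝ K.carrier :=
  uniqueDiffOn_convex K.convex_carrier K.nonempty_interior_carrier

theorem closure_interior_carrier : closure (interior K.carrier) = K.carrier := by
  rw [K.convex_carrier.closure_interior_eq_closure_of_nonempty_interior
    K.nonempty_interior_carrier, K.isCompact_carrier.isClosed.closure_eq]

/-- The divergence is the trace of the derivative, hence may be computed in any basis. It vanishes
inside, and by continuity on the closed simplex, which is the closure of its interior. -/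
theorem sum_coord_fderivWithin_eq_zero {ψ : Sp (n + 1) → Sp (n + 1)}
    (hψ : ContDiffOn ℝ 1 ψ K.carrier)
    (hdiv : ∀ x ∈ interior K.carrier,
      ∑ j, (fderiv ℝ ψ x (EuclideanSpace.single j 1)) j = 0) {x : Sp (n + 1)}
    (hx : x ∈ K.carrier) :
    ∑ m, K.pathBasis.coord m (fderivWithin ℝ ψ K.carrier x (K.pathBasis m)) = 0 := by
  have hc : ContinuousOn (fderivWithin ℝ ψ K.carrier) K.carrier :=
    hψ.continuousOn_fderivWithin K.uniqueDiffOn_carrier le_rfl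
  have hcont : ContinuousOn (fun x => ∑ m, K.pathBasis.coord m
      (fderivWithin ℝ ψ K.carrier x (K.pathBasis m))) K.carrier :=
    continuousOn_finsetSum _ fun m _ =>
      (K.pathBasis.coord m).continuous_of_finiteDimensional.comp_continuousOn
        (hc.clm_apply continuousOn_const)
  have hz : EqOn (fun x => ∑ m, K.pathBasis.coord m
      (fderivWithin ℝ ψ K.carrier x (K.pathBasis m))) (fun _ => 0) (interior K.carrier) := by
    intro x hx
    simp only
    rw [fderivWithin_of_mem_nhds (mem_interior_iff_mem_nhds.1 hx), ← hdiv x hx]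
    have h1 := LinearMap.trace_eq_sum_inner (fderiv ℝ ψ x).toLinearMap
      (EuclideanSpace.basisFun (Fin (n + 1)) ℝ)
    rw [LinearMap.trace_eq_matrix_trace ℝ K.pathBasis] at h1
    simpa [Matrix.trace, LinearMap.toMatrix_apply, EuclideanSpace.inner_single_left] using h1
  exact hz.of_subset_closure hcont continuousOn_const interior_subset
    K.closure_interior_carrier.symm.subset hx

/-- Expand ψ in the consecutive edges. The `m`-th component has flux only through the facets
`m.castSucc` and `m.succ`, with opposite signs, and their difference is the integral of its `m`-th
partial derivative. These derivatives add up to the divergence. -/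
theorem boundaryFlux_eq_zero {ψ : Sp (n + 1) → Sp (n + 1)} (hψ : ContDiffOn ℝ 1 ψ K.carrier)
    (hdiv : ∀ x ∈ interior K.carrier,
      ∑ j, (fderiv ℝ ψ x (EuclideanSpace.single j 1)) j = 0) :
    K.boundaryFlux ψ = 0 := by
  obtain ⟨c, hc⟩ := exists_setIntegral_refSimplex n
  -- The norm of the gradient in the surface element cancels the normalisation of the normal.
  have hface : ∀ i, K.faceIntegral i (fun x => inner ℝ (ψ x) (K.normal i)) =
      -(K.edgeDet * c) * ∫ z in kuhn n, (K.coord i).linear (ψ (point K (degen i z))) := by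
    intro i
    have hn := norm_ne_zero_iff.2 (K.gradCoord_ne_zero i)
    have : (fun z => inner ℝ (ψ (K.faceParam i (kuhnToRef n z))) (K.normal i)) = fun z =>
        -(‖K.gradCoord i‖⁻¹) * (K.coord i).linear (ψ (point K (degen i z))) := by
      funext z
      rw [faceParam_kuhnToRef, normal, inner_neg_right, real_inner_smul_right, real_inner_comm,
        inner_gradCoord, neg_mul]
    rw [faceIntegral, hc, this, integral_const_mul, faceJacobian_eq]
    field_simp
  set b := K.pathBasis with hb
  let g : Fin (n + 1) → (Fin (n + 1) → ℝ) → ℝ := fun m y => b.coord m (ψ (point K y))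
  have hgc : ∀ m i, IntegrableOn (fun z => g m (degen i z)) (kuhn n) := fun m i => by
    refine ContinuousOn.integrableOn_compact isCompact_kuhn ?_
    refine (b.coord m).continuous_of_finiteDimensional.comp_continuousOn ?_
    exact hψ.continuousOn.comp (K.continuous_point.comp (continuous_degen i)).continuousOn
      fun z hz => K.point_mem_carrier (degen_mem_kuhn i hz)
  have hsplit : ∀ i, ∫ z in kuhn n, (K.coord i).linear (ψ (point K (degen i z))) =
      ∑ m : Fin (n + 1), ((if i = m.succ then 1 else 0) - (if i = m.castSucc then 1 else 0)) *
        ∫ z in kuhn n, g m (degen i z) := by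
    intro i
    simp only [← integral_const_mul]
    rw [← integral_finsetSum _ fun m _ => (hgc m i).const_mul _]
    congr 1
    funext z
    conv_lhs => rw [← b.sum_repr (ψ (point K (degen i z)))]
    rw [map_sum]
    refine Finset.sum_congr rfl fun m _ => ?_
    rw [map_smul, hb, pathBasis_apply, coord_linear_sub, smul_eq_mul, mul_comm]
    rfl
  let T : (Fin (n + 1) → ℝ) →L[ℝ] Sp (n + 1) :=
    ∑ m, (ContinuousLinearMap.proj m : (Fin (n + 1) → ℝ) →L[ℝ] ℝ).smulRight (b m)
  have hT : ∀ y, HasFDerivAt (point K) T y := fun y => by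
    have : point K = fun y => K 0 + T y := by
      funext y
      rw [point_eq]
      simp [T, hb, pathBasis_apply]
    rw [this]
    exact T.hasFDerivAt.const_add _
  let c' : Fin (n + 1) → Sp (n + 1) →L[ℝ] ℝ := fun m => (b.coord m).toContinuousLinearMap
  let g' : Fin (n + 1) → (Fin (n + 1) → ℝ) → (Fin (n + 1) → ℝ) →L[ℝ] ℝ := fun m y =>
    (c' m).comp ((fderivWithin ℝ ψ K.carrier (point K y)).comp T)
  have hg : ∀ m, ∀ y ∈ kuhn (n + 1), HasFDerivWithinAt (g m) (g' m y) (kuhn (n + 1)) y := by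
    intro m y hy
    have h1 := (hψ.differentiableOn one_ne_zero _ (K.point_mem_carrier hy)).hasFDerivWithinAt
    have h2 := h1.comp y (hT y).hasFDerivWithinAt fun y hy => K.point_mem_carrier hy
    exact (c' m).hasFDerivAt.comp_hasFDerivWithinAt y h2
  have hg' : ∀ m, ContinuousOn (g' m) (kuhn (n + 1)) := by
    intro m
    have h1 : ContinuousOn (fun y => fderivWithin ℝ ψ K.carrier (point K y)) (kuhn (n + 1)) :=
      (hψ.continuousOn_fderivWithin K.uniqueDiffOn_carrier le_rfl).comp
        K.continuous_point.continuousOn fun y hy => K.point_mem_carrier hy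
    exact continuousOn_const.clm_comp (h1.clm_comp continuousOn_const)
  have hsum : ∑ m : Fin (n + 1), ∫ y in kuhn (n + 1), g' m y (Pi.single m 1) = 0 := by
    rw [← integral_finsetSum _ fun m _ => ((hg' m).clm_apply
      continuousOn_const).integrableOn_compact isCompact_kuhn]
    refine (setIntegral_congr_fun isClosed_kuhn.measurableSet fun y hy => ?_).trans
      (integral_zero _ _)
    have := K.sum_coord_fderivWithin_eq_zero hψ hdiv (K.point_mem_carrier hy)
    rw [← this]
    refine Finset.sum_congr rfl fun m _ => ?_
    have hTm : T (Pi.single m 1) = b m := by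
      simp [T, Pi.single_apply]
    change b.coord m (fderivWithin ℝ ψ K.carrier (point K y) (T (Pi.single m 1))) = _
    rw [hTm]
  rw [boundaryFlux]
  simp only [hface, ← Finset.mul_sum, hsplit]
  rw [Finset.sum_comm]
  have : ∀ m : Fin (n + 1), ∑ i : Fin (n + 2),
      ((if i = m.succ then 1 else 0) - (if i = m.castSucc then 1 else 0)) *
        ∫ z in kuhn n, g m (degen i z) = -∫ y in kuhn (n + 1), g' m y (Pi.single m 1) := by
    intro m
    rw [setIntegral_kuhn_deriv m (hg m) (hg' m), integral_sub (hgc m _) (hgc m _)]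
    simp [sub_mul, Finset.sum_sub_distrib]
  simp only [this, Finset.sum_neg_distrib, hsum, neg_zero, mul_zero]

end Simplex

/-! ### The entropy variable -/

namespace EntropySystem

variable {n p k : ℕ} (S : EntropySystem n p (k + 2))

theorem one_le_cast : (1 : WithTop ℕ∞) ≤ ((k + 2 : ℕ) : WithTop ℕ∞) := by
  exact_mod_cast (by omega : 1 ≤ k + 2)

theorem contDiffOn_entropyVar : ContDiffOn ℝ 1 S.entropyVar S.D := by
  have h : ContDiffOn ℝ 1 (fderiv ℝ S.U) S.D :=
    S.contDiff_U.fderiv_of_isOpen S.isOpen (by exact_mod_cast (by omega : 1 + 1 ≤ k + 2))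
  exact (InnerProductSpace.toDual ℝ (Sp p)).symm.contDiff.comp_contDiffOn h

/-- A positive definite Hessian is injective, hence invertible in finite dimension; this is the
input of the inverse function theorem. -/
theorem hasStrictFDerivAt_entropyVar {y : Sp p} (hy : y ∈ S.D) :
    ∃ A : Sp p ≃L[ℝ] Sp p, HasStrictFDerivAt S.entropyVar (A : Sp p →L[ℝ] Sp p) y := by
  have h := (S.contDiffOn_entropyVar.contDiffAt (S.isOpen.mem_nhds hy)).hasStrictFDerivAt
    one_ne_zero
  have hinj : Function.Injective (fderiv ℝ S.entropyVar y).toLinearMap := by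
    rw [injective_iff_map_eq_zero]
    intro w hw
    by_contra hne
    have := S.hessian_pos y hy w hne
    rw [show fderiv ℝ (gradient S.U) y w = 0 from hw, inner_zero_right] at this
    exact lt_irrefl _ this
  exact ⟨(LinearEquiv.ofInjectiveEndo _ hinj).toContinuousLinearEquiv, h⟩

/-- If ∇U agreed at a and b, the function ⟨b - a, ∇U⟩ along the segment, which lies in the convex
set D, would have a critical point, against positivity of the Hessian. -/
theorem injOn_entropyVar : InjOn S.entropyVar S.D := by
  intro a ha b hb hab
  by_contra hne
  have hne' : b - a ≠ 0 := sub_ne_zero.2 (Ne.symm hne)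
  have hmem : ∀ t ∈ Icc (0 : ℝ) 1, a + t • (b - a) ∈ S.D := fun t ht =>
    S.convex_U.1.add_smul_sub_mem ha hb ht
  have hline : ∀ t : ℝ, HasDerivAt (fun t : ℝ => a + t • (b - a)) (b - a) t := fun t => by
    simpa using ((hasDerivAt_id t).smul_const (b - a)).const_add a
  have hd : ∀ t ∈ Icc (0 : ℝ) 1,
      HasDerivAt (fun t : ℝ => inner ℝ (b - a) (S.entropyVar (a + t • (b - a))))
        (inner ℝ (b - a) (fderiv ℝ S.entropyVar (a + t • (b - a)) (b - a))) t := fun t ht => by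
    have h1 := ((S.contDiffOn_entropyVar.contDiffAt
      (S.isOpen.mem_nhds (hmem t ht))).differentiableAt one_ne_zero).hasFDerivAt
    exact (innerSL ℝ (b - a)).hasFDerivAt.comp_hasDerivAt t (h1.comp_hasDerivAt t (hline t))
  obtain ⟨c, hc, hslope⟩ := exists_hasDerivAt_eq_slope _ _ zero_lt_one
    (fun t ht => (hd t ht).continuousAt.continuousWithinAt)
    (fun t ht => hd t (Ioo_subset_Icc_self ht))
  have hpos := S.hessian_pos _ (hmem c (Ioo_subset_Icc_self hc)) _ hne'
  have : inner ℝ (b - a) (fderiv ℝ S.entropyVar (a + c • (b - a)) (b - a)) = 0 := by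
    rw [hslope]; simp [hab]
  exact hpos.ne' this

theorem consVar_entropyVar {y : Sp p} (hy : y ∈ S.D) : S.consVar (S.entropyVar y) = y :=
  S.injOn_entropyVar.leftInvOn_invFunOn hy

theorem fluxV_entropyVar (j : Fin (n + 1)) {y : Sp p} (hy : y ∈ S.D) :
    S.fluxV j (S.entropyVar y) = S.f j y := by
  rw [fluxV, S.consVar_entropyVar hy]

/-- Openness leaves room around the exact states for the discrete states and for their averages {V}.
-/
theorem isOpen_entropyStates : IsOpen S.entropyStates := by
  rw [isOpen_iff_mem_nhds]
  rintro _ ⟨y, hy, rfl⟩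
  obtain ⟨A, hA⟩ := S.hasStrictFDerivAt_entropyVar hy
  rw [← hA.map_nhds_eq_of_equiv]
  exact Filter.image_mem_map (S.isOpen.mem_nhds hy)

theorem hasStrictFDerivAt_consVar {v : Sp p} (hv : v ∈ S.entropyStates) :
    ∃ A : Sp p →L[ℝ] Sp p, HasStrictFDerivAt S.consVar A v := by
  obtain ⟨y, hy, rfl⟩ := hv
  obtain ⟨A, hA⟩ := S.hasStrictFDerivAt_entropyVar hy
  exact ⟨_, hA.to_local_left_inverse
    (Filter.eventually_of_mem (S.isOpen.mem_nhds hy) fun y hy => S.consVar_entropyVar hy)⟩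

theorem consVar_mem {v : Sp p} (hv : v ∈ S.entropyStates) : S.consVar v ∈ S.D := by
  obtain ⟨y, hy, rfl⟩ := hv
  rwa [S.consVar_entropyVar hy]

theorem entropyVar_consVar {v : Sp p} (hv : v ∈ S.entropyStates) :
    S.entropyVar (S.consVar v) = v := by
  obtain ⟨y, hy, rfl⟩ := hv
  rw [S.consVar_entropyVar hy]

theorem contDiffAt_f (j : Fin (n + 1)) {y : Sp p} (hy : y ∈ S.D) : ContDiffAt ℝ 1 (S.f j) y :=
  ((S.contDiff_f j).contDiffAt (S.isOpen.mem_nhds hy)).of_le one_le_cast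

theorem contDiffAt_g (j : Fin (n + 1)) {y : Sp p} (hy : y ∈ S.D) : ContDiffAt ℝ 1 (S.g j) y :=
  ((S.contDiff_g j).contDiffAt (S.isOpen.mem_nhds hy)).of_le one_le_cast

theorem exists_lipschitzOnWith_fluxV (j : Fin (n + 1)) {v : Sp p} (hv : v ∈ S.entropyStates) :
    ∃ L, ∃ s ∈ 𝓝 v, LipschitzOnWith L (S.fluxV j) s := by
  obtain ⟨A, hA⟩ := S.hasStrictFDerivAt_consVar hv
  exact (((S.contDiffAt_f j (S.consVar_mem hv)).hasStrictFDerivAt one_ne_zero).comp v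
    hA).exists_lipschitzOnWith

/-- In dθ_j = ⟨dV, f_j⟩ + ⟨V, df_j⟩ - dg_j the last two terms cancel by compatibility of the entropy
pair. -/
theorem hasFDerivAt_potential (j : Fin (n + 1)) {v : Sp p} (hv : v ∈ S.entropyStates) :
    HasFDerivAt (S.potential j) (innerSL ℝ (S.fluxV j v)) v := by
  obtain ⟨A, hA⟩ := S.hasStrictFDerivAt_consVar hv
  have hm := S.consVar_mem hv
  have hf := ((S.contDiffAt_f j hm).differentiableAt one_ne_zero).hasFDerivAt.comp v
    hA.hasFDerivAt
  have hg := ((S.contDiffAt_g j hm).differentiableAt one_ne_zero).hasFDerivAt.comp v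
    hA.hasFDerivAt
  have h := ((hasFDerivAt_id v).inner ℝ hf).sub hg
  refine h.congr_fderiv ?_
  ext w
  have hc := S.compatible j _ hm (A w)
  rw [show gradient S.U (S.consVar v) = v from S.entropyVar_consVar hv] at hc
  simp only [_root_.sub_apply, ContinuousLinearMap.comp_apply,
    ContinuousLinearMap.prod_apply, fderivInnerCLM_apply, ContinuousLinearMap.id_apply, id,
    Function.comp, innerSL_apply_apply]
  rw [← hc, fluxV, real_inner_comm w]
  ring

/-- Quadratic Taylor expansion of the potential, uniformly on compact sets of states. -/
theorem exists_potential_taylor {A : Set (Sp p)} (hA : IsCompact A) (hsub : A ⊆ S.entropyStates) :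
    ∃ ρ : ℝ, 0 < ρ ∧ ∃ C : ℝ, 0 ≤ C ∧ ∀ v ∈ A, ∀ w, ‖w - v‖ ≤ ρ → ∀ j,
      |S.potential j w - S.potential j v - inner ℝ (w - v) (S.fluxV j v)| ≤ C * ‖w - v‖ ^ 2 := by
  -- Compactness reduces to a neighbourhood of one state, where the gradient f_j of the potential is
  -- Lipschitz.
  refine hA.induction_on (p := fun A => ∃ ρ : ℝ, 0 < ρ ∧ ∃ C : ℝ, 0 ≤ C ∧ ∀ v ∈ A, ∀ w,
    ‖w - v‖ ≤ ρ → ∀ j, |S.potential j w - S.potential j v - inner ℝ (w - v) (S.fluxV j v)| ≤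
      C * ‖w - v‖ ^ 2) ⟨1, one_pos, 0, le_rfl, by simp⟩ ?_ ?_ ?_
  · rintro s t hst ⟨ρ, hρ, C, hC, h⟩
    exact ⟨ρ, hρ, C, hC, fun v hv => h v (hst hv)⟩
  · rintro s t ⟨ρ, hρ, C, hC, h⟩ ⟨ρ', hρ', C', hC', h'⟩
    refine ⟨min ρ ρ', lt_min hρ hρ', max C C', hC.trans (le_max_left _ _), ?_⟩
    rintro v (hv | hv) w hw j
    · exact (h v hv w (hw.trans (min_le_left _ _)) j).trans (by gcongr; exact le_max_left _ _)
    · exact (h' v hv w (hw.trans (min_le_right _ _)) j).trans (by gcongr; exact le_max_right _ _)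
  · intro v₀ hv₀
    choose L s hs hL using fun j => S.exists_lipschitzOnWith_fluxV j (hsub hv₀)
    have hnhds : (⋂ j, s j) ∩ S.entropyStates ∈ 𝓝 v₀ :=
      Filter.inter_mem (Filter.iInter_mem.2 hs) (S.isOpen_entropyStates.mem_nhds (hsub hv₀))
    obtain ⟨ε, hε, hball⟩ := Metric.mem_nhds_iff.1 hnhds
    refine ⟨Metric.ball v₀ (ε / 2),
      mem_nhdsWithin_of_mem_nhds (Metric.ball_mem_nhds _ (by positivity)), ε / 4, by positivity,
      ∑ j, (L j : ℝ), by positivity, fun v hv w hw j => ?_⟩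
    have hin : ∀ z ∈ Metric.closedBall v ‖w - v‖, z ∈ (⋂ j, s j) ∩ S.entropyStates :=
      fun z hz => hball <| by
        have h1 := Metric.mem_closedBall.1 hz
        have h2 := Metric.mem_ball.1 hv
        have := dist_triangle z v v₀
        exact Metric.mem_ball.2 (by linarith)
    have hvm : v ∈ Metric.closedBall v ‖w - v‖ := Metric.mem_closedBall_self (norm_nonneg _)
    have hwm : w ∈ Metric.closedBall v ‖w - v‖ := by rw [Metric.mem_closedBall, dist_eq_norm]
    -- On this ball the gradient varies by at most `L j * ‖w - v‖`; the mean value inequality then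
    -- gives a quadratic remainder without a second derivative of θ_j.
    have key := (convex_closedBall v ‖w - v‖).norm_image_sub_le_of_norm_hasFDerivWithin_le'
      (f := S.potential j) (f' := fun z => innerSL ℝ (S.fluxV j z)) (φ := innerSL ℝ (S.fluxV j v))
      (C := L j * ‖w - v‖)
      (fun z hz => (S.hasFDerivAt_potential j (hin z hz).2).hasFDerivWithinAt)
      (fun z hz => by
        rw [← map_sub, innerSL_apply_norm, ← dist_eq_norm]
        refine ((hL j).dist_le_mul z (mem_iInter.1 (hin z hz).1 j) v
          (mem_iInter.1 (hin v hvm).1 j)).trans ?_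
        gcongr
        exact Metric.mem_closedBall.1 hz) hvm hwm
    rw [innerSL_apply_apply, Real.norm_eq_abs, real_inner_comm] at key
    refine key.trans ?_
    rw [mul_assoc, ← sq]
    gcongr
    exact Finset.single_le_sum (f := fun j => (L j : ℝ)) (fun _ _ => NNReal.coe_nonneg _)
      (Finset.mem_univ j)

end EntropySystem

/-! ### Meshes: sizes, areas and neighbours -/

namespace Simplex

variable {n : ℕ} (K : Simplex n)

theorem face_subset_carrier (i : Fin (n + 2)) : K.face i ⊆ K.carrier :=
  convexHull_mono (image_subset_range _ _)

theorem vertex_mem_carrier (i : Fin (n + 2)) : K i ∈ K.carrier :=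
  subset_convexHull ℝ _ (mem_range_self i)

theorem dist_le_diam {x y : Sp (n + 1)} (hx : x ∈ K.carrier) (hy : y ∈ K.carrier) :
    dist x y ≤ Metric.diam K.carrier :=
  Metric.dist_le_diam_of_mem K.isCompact_carrier.isBounded hx hy

theorem diam_pos : 0 < Metric.diam K.carrier := by
  refine lt_of_lt_of_le (dist_pos.2 ?_) (K.dist_le_diam (K.vertex_mem_carrier 0)
    (K.vertex_mem_carrier 1))
  exact fun h => zero_ne_one (K.ind.injective h)

theorem faceArea_eq (i : Fin (n + 2)) :
    K.faceArea i = K.faceJacobian i * volume.real (refSimplex n) := by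
  simp [faceArea, faceIntegral]

theorem faceArea_nonneg (i : Fin (n + 2)) : 0 ≤ K.faceArea i := by
  rw [faceArea_eq]; exact mul_nonneg (Real.sqrt_nonneg _) measureReal_nonneg

/-- The entries of the Gram matrix are at most the squared diameter; the Leibniz expansion has n!
terms. -/
theorem faceArea_le (i : Fin (n + 2)) :
    K.faceArea i ≤ Real.sqrt n.factorial * volume.real (refSimplex n) *
      Metric.diam K.carrier ^ n := by
  set h := Metric.diam K.carrier
  have hle : ∀ j, ‖K.faceEdge i j‖ ≤ h := fun j => by
    rw [faceEdge, ← dist_eq_norm]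
    exact K.dist_le_diam (K.vertex_mem_carrier _) (K.vertex_mem_carrier _)
  have hdet := Matrix.det_le (abv := AbsoluteValue.abs) (x := h ^ 2)
    (A := Matrix.of fun j l : Fin n => inner ℝ (K.faceEdge i j) (K.faceEdge i l)) fun j l => by
      refine (abs_real_inner_le_norm (K.faceEdge i j) (K.faceEdge i l)).trans ?_
      rw [sq]
      exact mul_le_mul (hle j) (hle l) (norm_nonneg _) ((norm_nonneg _).trans (hle j))
  have hJ : K.faceJacobian i ≤ Real.sqrt n.factorial * h ^ n := by
    refine Real.sqrt_le_iff.2 ⟨by positivity, ((le_abs_self _).trans hdet).trans_eq ?_⟩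
    rw [Fintype.card_fin, mul_pow, Real.sq_sqrt (Nat.cast_nonneg _), nsmul_eq_mul]
    ring
  rw [faceArea_eq]
  calc K.faceJacobian i * volume.real (refSimplex n)
      ≤ (Real.sqrt n.factorial * h ^ n) * volume.real (refSimplex n) :=
        mul_le_mul_of_nonneg_right hJ measureReal_nonneg
    _ = _ := by ring

end Simplex

namespace Mesh

variable {n : ℕ} {Ω : Set (Sp (n + 1))}

theorem carrier_subset (M : Mesh n Ω) (c : M.Cell) : (M.simplex c).carrier ⊆ closure Ω := by
  rw [← M.cover]; exact subset_iUnion (fun c => (M.simplex c).carrier) c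

/-- Boundedness of Ω is a consequence of its having a finite mesh. -/
theorem isCompact_closure (M : Mesh n Ω) : IsCompact (closure Ω) := by
  have := M.finite
  rw [← M.cover]
  exact isCompact_iUnion fun c => (M.simplex c).isCompact_carrier

theorem uniqueDiffOn_closure (M : Mesh n Ω) : UniqueDiffOn ℝ (closure Ω) := by
  intro x hx
  rw [← M.cover] at hx
  obtain ⟨c, hc⟩ := mem_iUnion.1 hx
  exact ((M.simplex c).uniqueDiffOn_carrier x hc).mono (M.carrier_subset c)

theorem diam_le_size (M : Mesh n Ω) (c : M.Cell) : Metric.diam (M.simplex c).carrier ≤ M.size := by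
  have := M.finite
  exact le_ciSup (f := fun c => Metric.diam (M.simplex c).carrier) (finite_range _).bddAbove c

theorem size_pos (M : Mesh n Ω) (c : M.Cell) : 0 < M.size :=
  (M.simplex c).diam_pos.trans_le (M.diam_le_size c)

/-- Thus the approximation property controls both traces at every quadrature node. -/
theorem face_subset_across (M : Mesh n Ω) (c : M.Cell) (i : Fin (n + 2)) :
    (M.simplex c).face i ⊆ (M.simplex (M.across c i)).carrier := by
  unfold across
  split_ifs with h
  · refine convexHull_mono ?_
    rintro _ ⟨j, hj, rfl⟩
    exact h.choose_spec.2 j hj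
  · exact (M.simplex c).face_subset_carrier i

theorem exists_faceArea_le (n : ℕ) : ∃ C : ℝ, 0 ≤ C ∧ ∀ (Ω : Set (Sp (n + 1))) (M : Mesh n Ω)
    (c : M.Cell) (i : Fin (n + 2)), (M.simplex c).faceArea i ≤ C * M.size ^ n := by
  refine ⟨Real.sqrt n.factorial * volume.real (refSimplex n), by positivity,
    fun Ω M c i => ((M.simplex c).faceArea_le i).trans ?_⟩
  gcongr
  exact M.diam_le_size c

/-- A function of class `C^1` on the closure of `Ω` is Lipschitz continuous on every cell of every
mesh, with a uniform constant. -/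
theorem exists_lipschitz {ι : Type*} (M : ι → Mesh n Ω) {F : Type*} [NormedAddCommGroup F]
    [NormedSpace ℝ F] {φ : Sp (n + 1) → F} (hφ : ContDiffOn ℝ 1 φ (closure Ω)) :
    ∃ L : ℝ, 0 ≤ L ∧ ∀ a c, ∀ x ∈ ((M a).simplex c).carrier, ∀ y ∈ ((M a).simplex c).carrier,
      ‖φ x - φ y‖ ≤ L * (M a).size := by
  rcases isEmpty_or_nonempty ι with h | ⟨⟨a₀⟩⟩
  · exact ⟨0, le_rfl, fun a => isEmptyElim a⟩
  obtain ⟨L, hL⟩ := (M a₀).isCompact_closure.exists_bound_of_continuousOn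
    (hφ.continuousOn_fderivWithin (M a₀).uniqueDiffOn_closure le_rfl)
  refine ⟨|L|, abs_nonneg _, fun a c x hx y hy => ?_⟩
  have hsub := (M a).carrier_subset c
  -- The closure of Ω need not be convex, so the mean value inequality is applied inside the cell.
  have h := ((M a).simplex c).convex_carrier.norm_image_sub_le_of_norm_hasFDerivWithin_le
    (fun z hz => ((hφ.differentiableOn one_ne_zero z (hsub hz)).hasFDerivWithinAt).mono hsub)
    (fun z hz => (hL z (hsub hz)).trans (le_abs_self L)) hy hx
  refine h.trans ?_
  gcongr
  rw [← dist_eq_norm]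
  exact (((M a).simplex c).dist_le_diam hx hy).trans ((M a).diam_le_size c)

end Mesh

/-! ### Quadrature -/

namespace BoundaryQuadrature

variable {n : ℕ} {Ω : Set (Sp (n + 1))} {M : Mesh n Ω} (Q : BoundaryQuadrature M)

theorem integral_sub {F : Type*} [AddCommGroup F] [Module ℝ F] (c : M.Cell)
    (v w : Fin (n + 2) → Sp (n + 1) → F) :
    Q.integral c (fun i x => v i x - w i x) = Q.integral c v - Q.integral c w := by
  simp [integral, smul_sub, Finset.sum_sub_distrib]

theorem map_integral {F G : Type*} [AddCommGroup F] [Module ℝ F] [AddCommGroup G] [Module ℝ G]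
    (L : F →ₗ[ℝ] G) (c : M.Cell) (v : Fin (n + 2) → Sp (n + 1) → F) :
    L (Q.integral c v) = Q.integral c fun i x => L (v i x) := by
  simp [integral, map_sum, map_smul]

theorem norm_integral_le {F : Type*} [NormedAddCommGroup F] [NormedSpace ℝ F] (c : M.Cell)
    {v : Fin (n + 2) → Sp (n + 1) → F} {A W B : ℝ} (hB : 0 ≤ B)
    (hA : ∀ i, (M.simplex c).faceArea i ≤ A) (hW : ∀ i, ∑ q, |(Q.rule c i).weight q| ≤ W)
    (hv : ∀ i, ∀ x ∈ (M.simplex c).face i, ‖v i x‖ ≤ B) :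
    ‖Q.integral c v‖ ≤ (n + 2) * A * W * B := by
  have hterm : ∀ i, ‖(M.simplex c).faceArea i •
      ∑ q, (Q.rule c i).weight q • v i ((Q.rule c i).node q)‖ ≤ A * (W * B) := by
    intro i
    rw [norm_smul, Real.norm_of_nonneg ((M.simplex c).faceArea_nonneg i)]
    refine mul_le_mul (hA i) ?_ (norm_nonneg _)
      (((M.simplex c).faceArea_nonneg i).trans (hA i))
    calc ‖∑ q, (Q.rule c i).weight q • v i ((Q.rule c i).node q)‖
        ≤ ∑ q, |(Q.rule c i).weight q| * B := by
          refine norm_sum_le_of_le _ fun q _ => ?_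
          rw [norm_smul, Real.norm_eq_abs]
          gcongr
          exact hv i _ (Q.node_mem c i q)
      _ = (∑ q, |(Q.rule c i).weight q|) * B := by rw [Finset.sum_mul]
      _ ≤ W * B := by gcongr; exact hW i
  refine (norm_sum_le_of_le _ fun i _ => hterm i).trans_eq ?_
  simp
  ring

end BoundaryQuadrature

/-! ### Degrees of freedom -/

namespace FiniteElement

variable {n k : ℕ} {Dof : Type*} [Fintype Dof]

theorem sum_shape (P : FiniteElement n k Dof) (K : Simplex n) (x : Sp (n + 1)) :
    ∑ σ, P.shape K σ x = 1 := by
  simp only [shape, ← map_sum, P.sum_eq_one, map_one]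

theorem nonempty_dof (P : FiniteElement n k Dof) : Nonempty Dof := by
  by_contra h
  rw [not_nonempty_iff] at h
  have := P.sum_eq_one
  simp at this

theorem isCompact_refSimplex (m : ℕ) : IsCompact (refSimplex m) := by
  refine (isCompact_univ_pi fun _ : Fin m =>
    isCompact_Icc (a := (0 : ℝ)) (b := 1)).of_isClosed_subset ?_ ?_
  · have : refSimplex m = (⋂ j, {t | 0 ≤ t j}) ∩ {t | ∑ j, t j ≤ 1} := by
      ext t; simp [refSimplex]
    rw [this]
    exact (isClosed_iInter fun j => isClosed_le continuous_const (continuous_apply j)).inter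
      (isClosed_le (continuous_finsetSum _ fun j _ => continuous_apply j) continuous_const)
  · rintro t ⟨h0, h1⟩ j -
    exact ⟨h0 j, (Finset.single_le_sum (fun i _ => h0 i) (Finset.mem_univ j)).trans h1⟩

theorem exists_mem_carrier (K : Simplex n) {t : Fin (n + 1) → ℝ} (ht : t ∈ refSimplex (n + 1)) :
    ∃ x ∈ K.carrier, ∀ j : Fin (n + 1), K.coord j.succ x = t j := by
  let w : Fin (n + 2) → ℝ := Fin.cons (1 - ∑ j, t j) t
  have hw : ∑ i, w i = 1 := by simp [w, Fin.sum_univ_succ]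
  have hw0 : ∀ i, 0 ≤ w i := fun i => by
    refine Fin.cases ?_ (fun j => ?_) i
    · simpa [w] using ht.2
    · simpa [w] using ht.1 j
  refine ⟨Finset.univ.affineCombination ℝ K w, ?_, fun j => ?_⟩
  · rw [Finset.affineCombination_eq_linear_combination _ _ _ hw]
    exact K.convex_carrier.sum_mem (fun i _ => hw0 i) hw fun i _ => K.vertex_mem_carrier i
  · rw [K.coord_apply_combination_of_mem (Finset.mem_univ _) hw]
    simp [w]

/-- The coefficients of a polynomial are bounded by its maximum on the reference simplex. -/
theorem exists_coeff_bound (P : FiniteElement n k Dof) : ∃ C : ℝ, 0 ≤ C ∧ ∀ (w : Dof → ℝ) (ε : ℝ),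
    (∀ t ∈ refSimplex (n + 1),
      |∑ σ, MvPolynomial.eval t (P.basis σ : MvPolynomial (Fin (n + 1)) ℝ) * w σ| ≤ ε) →
    ∀ σ, |w σ| ≤ C * ε := by
  have : CompactSpace (refSimplex (n + 1)) := isCompact_iff_compactSpace.1 (isCompact_refSimplex _)
  have hne : Nonempty (refSimplex (n + 1)) := ⟨⟨0, by simp [refSimplex]⟩⟩
  let e : Dof → C(refSimplex (n + 1), ℝ) := fun σ =>
    ⟨fun t => MvPolynomial.eval t.1 (P.basis σ : MvPolynomial (Fin (n + 1)) ℝ),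
      (MvPolynomial.continuous_eval _).comp continuous_subtype_val⟩
  let T : (Dof → ℝ) →ₗ[ℝ] C(refSimplex (n + 1), ℝ) := Fintype.linearCombination ℝ e
  have hTapp : ∀ w t, T w t =
      ∑ σ, MvPolynomial.eval t.1 (P.basis σ : MvPolynomial (Fin (n + 1)) ℝ) * w σ := fun w t => by
    simp [T, e, Fintype.linearCombination_apply, ContinuousMap.sum_apply, mul_comm]
  have hker : T.ker = ⊥ := by
    rw [LinearMap.ker_eq_bot']
    intro w hw
    have hp : (∑ σ, w σ • (P.basis σ : MvPolynomial (Fin (n + 1)) ℝ)) = 0 := by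
      -- A polynomial vanishing on a product of infinite sets is zero; this cube of side 1/d fits in
      -- the reference simplex.
      refine MvPolynomial.funext_set (fun _ : Fin (n + 1) => Icc (0 : ℝ) (1 / (n + 1)))
        (fun _ => Icc_infinite (by positivity)) fun t ht => ?_
      have htm : t ∈ refSimplex (n + 1) := by
        refine ⟨fun j => (ht j (mem_univ j)).1, ?_⟩
        calc ∑ j, t j ≤ ∑ _j : Fin (n + 1), (1 / (n + 1) : ℝ) :=
              Finset.sum_le_sum fun j _ => (ht j (mem_univ j)).2
          _ = 1 := by simp; field_simp
      have := hTapp w ⟨t, htm⟩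
      rw [hw] at this
      simpa [MvPolynomial.smul_eval, mul_comm] using this.symm
    have hb : ∑ σ, w σ • P.basis σ = 0 := by
      apply Subtype.ext
      simpa using hp
    funext σ
    exact Fintype.linearIndependent_iff.1 P.basis.linearIndependent w hb σ
  -- An injective linear map from a finite-dimensional space is bounded below.
  obtain ⟨C, -, hC⟩ := T.exists_antilipschitzWith hker
  refine ⟨C, C.2, fun w ε hε σ => ?_⟩
  have hε0 : 0 ≤ ε := (abs_nonneg _).trans (hε _ hne.some.2)
  have h1 : ‖w‖ ≤ C * ‖T w‖ := by simpa using hC.le_mul_dist w 0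
  refine (norm_le_pi_norm w σ).trans (h1.trans ?_)
  refine mul_le_mul_of_nonneg_left ((ContinuousMap.norm_le _ hε0).2 fun t => ?_) C.2
  rw [hTapp]
  exact hε t.1 t.2

/-- Barycentric coordinates carry the shape functions of K to fixed polynomials on the reference
simplex, so the constant does not depend on K. The factor `p` sums the componentwise bounds. -/
theorem exists_dof_bound (P : FiniteElement n k Dof) (p : ℕ) :
    ∃ C : ℝ, 0 ≤ C ∧ ∀ (K : Simplex n) (w : Dof → Sp p) (ε : ℝ),
    (∀ x ∈ K.carrier, ‖∑ σ, P.shape K σ x • w σ‖ ≤ ε) → ∀ σ, ‖w σ‖ ≤ C * ε := by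
  obtain ⟨C, hC, h⟩ := P.exists_coeff_bound
  refine ⟨p * C, by positivity, fun K w ε hε σ => ?_⟩
  have hl : ∀ l, |w σ l| ≤ C * ε := by
    intro l
    refine h (fun σ => w σ l) ε (fun t ht => ?_) σ
    obtain ⟨x, hx, hxt⟩ := exists_mem_carrier K ht
    refine le_trans ?_ (hε x hx)
    refine le_trans (le_of_eq ?_) (PiLp.norm_apply_le (∑ σ, P.shape K σ x • w σ) l)
    rw [Real.norm_eq_abs]
    simp [shape, hxt]
  rw [← (EuclideanSpace.basisFun (Fin p) ℝ).sum_repr (w σ)]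
  refine (norm_sum_le_of_le (f := fun l => (EuclideanSpace.basisFun (Fin p) ℝ).repr (w σ) l •
    EuclideanSpace.basisFun (Fin p) ℝ l) (n := fun _ => C * ε) _ fun l _ => ?_).trans_eq ?_
  · rw [norm_smul, OrthonormalBasis.norm_eq_one, mul_one]
    simpa using hl l
  · simp [mul_assoc]

end FiniteElement

/-! ### Calculus of orders of magnitude -/

namespace IsBigOMesh

variable {n : ℕ} {Ω : Set (Sp (n + 1))} {ι : Type*} {M : ι → Mesh n Ω}

theorem exists_nonneg {e : ∀ a, (M a).Cell → ℝ} {m : ℕ} (h : IsBigOMesh M e m) :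
    ∃ C : ℝ, 0 ≤ C ∧ ∃ h₀ : ℝ, 0 < h₀ ∧ ∀ a, (M a).size ≤ h₀ → ∀ c,
      |e a c| ≤ C * (M a).size ^ m := by
  obtain ⟨C, h₀, hh, H⟩ := h
  refine ⟨|C|, abs_nonneg _, h₀, hh, fun a ha c => (H a ha c).trans ?_⟩
  have := ((M a).size_pos c).le
  gcongr
  exact le_abs_self C

theorem mono {e e' : ∀ a, (M a).Cell → ℝ} {m : ℕ} (h : IsBigOMesh M e m)
    (hle : ∀ a c, |e' a c| ≤ |e a c|) : IsBigOMesh M e' m := by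
  obtain ⟨C, h₀, hh, H⟩ := h
  exact ⟨C, h₀, hh, fun a ha c => (hle a c).trans (H a ha c)⟩

theorem of_le {e : ∀ a, (M a).Cell → ℝ} {m m' : ℕ} (h : IsBigOMesh M e m) (hm : m' ≤ m) :
    IsBigOMesh M e m' := by
  obtain ⟨C, hC, h₀, hh, H⟩ := h.exists_nonneg
  refine ⟨C, min h₀ 1, lt_min hh one_pos, fun a ha c =>
    (H a (ha.trans (min_le_left _ _)) c).trans ?_⟩
  exact mul_le_mul_of_nonneg_left (pow_le_pow_of_le_one ((M a).size_pos c).le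
    (ha.trans (min_le_right _ _)) hm) hC

theorem of_bound {e : ∀ a, (M a).Cell → ℝ} {C : ℝ} (h : ∀ a c, |e a c| ≤ C) :
    IsBigOMesh M e 0 := ⟨C, 1, one_pos, fun a _ c => by simpa using h a c⟩

theorem add {e e' : ∀ a, (M a).Cell → ℝ} {m : ℕ} (h : IsBigOMesh M e m)
    (h' : IsBigOMesh M e' m) : IsBigOMesh M (fun a c => e a c + e' a c) m := by
  obtain ⟨C, h₀, hh, H⟩ := h
  obtain ⟨C', h₀', hh', H'⟩ := h'
  refine ⟨C + C', min h₀ h₀', lt_min hh hh', fun a ha c => (abs_add_le _ _).trans ?_⟩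
  rw [add_mul]
  exact add_le_add (H a (ha.trans (min_le_left _ _)) c) (H' a (ha.trans (min_le_right _ _)) c)

theorem mul {e e' : ∀ a, (M a).Cell → ℝ} {m m' : ℕ} (h : IsBigOMesh M e m)
    (h' : IsBigOMesh M e' m') : IsBigOMesh M (fun a c => e a c * e' a c) (m + m') := by
  obtain ⟨C, hC, h₀, hh, H⟩ := h.exists_nonneg
  obtain ⟨C', hC', h₀', hh', H'⟩ := h'.exists_nonneg
  refine ⟨C * C', min h₀ h₀', lt_min hh hh', fun a ha c => ?_⟩
  have := ((M a).size_pos c).le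
  rw [abs_mul, pow_add, mul_mul_mul_comm]
  exact mul_le_mul (H a (ha.trans (min_le_left _ _)) c) (H' a (ha.trans (min_le_right _ _)) c)
    (abs_nonneg _) (by positivity)

theorem sum {κ : Type*} (s : Finset κ) {e : κ → ∀ a, (M a).Cell → ℝ} {m : ℕ}
    (h : ∀ i, IsBigOMesh M (e i) m) : IsBigOMesh M (fun a c => ∑ i ∈ s, e i a c) m := by
  classical
  induction s using Finset.induction_on with
  | empty => exact ⟨0, 1, one_pos, by simp⟩
  | insert i s hi ih => simpa only [Finset.sum_insert hi] using (h i).add ih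

end IsBigOMesh

/-- The quadrature of a pointwise `O(h^m)` quantity on element boundaries is `O(h^(m + d - 1))`. -/
theorem BoundedWeights.isBigOMesh {n : ℕ} {Ω : Set (Sp (n + 1))} {ι : Type*} {M : ι → Mesh n Ω}
    {Q : ∀ a, BoundaryQuadrature (M a)} (hQ : BoundedWeights Q) {F : Type*} [NormedAddCommGroup F]
    [NormedSpace ℝ F] {v : ∀ a, (M a).Cell → Fin (n + 2) → Sp (n + 1) → F} {m : ℕ}
    (hv : ∃ C : ℝ, ∃ h₀ : ℝ, 0 < h₀ ∧ ∀ a, (M a).size ≤ h₀ → ∀ c i,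
      ∀ x ∈ ((M a).simplex c).face i, ‖v a c i x‖ ≤ C * (M a).size ^ m) :
    IsBigOMesh M (fun a c => ‖(Q a).integral c (v a c)‖) (m + n) := by
  obtain ⟨C, h₀, hh, H⟩ := hv
  obtain ⟨W, hW⟩ := hQ
  obtain ⟨A, hA, harea⟩ := Mesh.exists_faceArea_le n
  refine ⟨(n + 2) * A * W * |C|, h₀, hh, fun a ha c => ?_⟩
  have hs := ((M a).size_pos c).le
  rw [abs_norm]
  refine ((Q a).norm_integral_le c (B := |C| * (M a).size ^ m) (by positivity)
    (fun i => harea Ω (M a) c i) (fun i => hW a c i) fun i x hx =>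
      (H a ha c i x hx).trans (by gcongr; exact le_abs_self C)).trans_eq ?_
  rw [pow_add]; ring

/-! ### Exact fluxes of a steady solution -/

namespace EntropySystem.IsSmoothSteadySolution

variable {n p k : ℕ} {Ω : Set (Sp (n + 1))} {S : EntropySystem n p (k + 2)}
  {u : Sp (n + 1) → Sp p}

theorem contDiffOn_comp (hu : S.IsSmoothSteadySolution Ω u) {F : Type*} [NormedAddCommGroup F]
    [NormedSpace ℝ F] {φ : Sp p → F} {m : WithTop ℕ∞} (hm : m ≤ (k + 2 : ℕ))
    (hφ : ContDiffOn ℝ m φ S.D) : ContDiffOn ℝ m (fun x => φ (u x)) (closure Ω) :=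
  hφ.comp (hu.contDiff.of_le hm) hu.mem

theorem fderiv_apply_coord {d m : ℕ} {ψ : Sp d → Sp m} {x : Sp d} (h : DifferentiableAt ℝ ψ x)
    (e : Sp d) (j : Fin m) : (fderiv ℝ ψ x e) j = fderiv ℝ (fun y => ψ y j) x e := by
  have := (EuclideanSpace.proj j : Sp m →L[ℝ] ℝ).hasFDerivAt.comp x h.hasFDerivAt
  exact (DFunLike.congr_fun this.fderiv e).symm

/-- The quadrature of a divergence-free flux is of the order of the quadrature error. -/
theorem isBigOMesh_integral_flux (hΩ : IsOpen Ω) {ι : Type*} {M : ι → Mesh n Ω}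
    {Q : ∀ a, BoundaryQuadrature (M a)} (hquad : QuadratureOrder Q k)
    {φ : Fin (n + 1) → Sp (n + 1) → ℝ}
    (hφ : ∀ j, ContDiffOn ℝ (k + 2 : ℕ) (φ j) (closure Ω))
    (hdiv : ∀ x ∈ Ω, ∑ j, fderiv ℝ (φ j) x (EuclideanSpace.single j 1) = 0) :
    IsBigOMesh M (fun a c => (Q a).integral c fun i x =>
      ∑ j, ((M a).simplex c).normal i j * φ j x) (k + (n + 1) + 1) := by
  let ψ : Sp (n + 1) → Sp (n + 1) := fun x => WithLp.toLp 2 fun j => φ j x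
  have hψ : ContDiffOn ℝ (k + 2 : ℕ) ψ (closure Ω) := contDiffOn_euclidean.2 hφ
  -- With zero exact flux, the quadrature value is its own error.
  have hflux : ∀ a c, ((M a).simplex c).boundaryFlux ψ = 0 := fun a c => by
    refine Simplex.boundaryFlux_eq_zero _
      ((hψ.of_le one_le_cast).mono ((M a).carrier_subset c)) fun x hx => ?_
    have hxΩ := (M a).interior_subset c hx
    have hd : DifferentiableAt ℝ ψ x := ((hψ.of_le one_le_cast).contDiffAt
      (Filter.mem_of_superset (hΩ.mem_nhds hxΩ) subset_closure)).differentiableAt one_ne_zero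
    rw [← hdiv x hxΩ]
    exact Finset.sum_congr rfl fun j _ => fderiv_apply_coord hd _ j
  refine (hquad ψ hψ).mono fun a c => le_of_eq ?_
  rw [hflux, sub_zero]
  simp [ψ, PiLp.inner_apply]

theorem differentiableAt_f (hΩ : IsOpen Ω) (hu : S.IsSmoothSteadySolution Ω u) (j : Fin (n + 1))
    {x : Sp (n + 1)} (hx : x ∈ Ω) : DifferentiableAt ℝ (fun y => S.f j (u y)) x :=
  ((hu.contDiffOn_comp one_le_cast ((S.contDiff_f j).of_le one_le_cast)).contDiffAt
    (Filter.mem_of_superset (hΩ.mem_nhds hx) subset_closure)).differentiableAt one_ne_zero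

theorem isBigOMesh_integral_f (hΩ : IsOpen Ω) (hu : S.IsSmoothSteadySolution Ω u) {ι : Type*}
    {M : ι → Mesh n Ω} {Q : ∀ a, BoundaryQuadrature (M a)} (hquad : QuadratureOrder Q k) :
    IsBigOMesh M (fun a c => ‖(Q a).integral c fun i x =>
      ∑ j, ((M a).simplex c).normal i j • S.f j (u x)‖) (k + (n + 1) + 1) := by
  have h : ∀ m : Fin p, IsBigOMesh M (fun a c => |(Q a).integral c fun i x =>
      ∑ j, ((M a).simplex c).normal i j * S.f j (u x) m|) (k + (n + 1) + 1) := fun m => by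
    refine (isBigOMesh_integral_flux hΩ hquad (φ := fun j x => S.f j (u x) m) (fun j => ?_)
      fun x hx => ?_).mono fun a c => (abs_abs _).le
    · exact contDiffOn_euclidean.1 (hu.contDiffOn_comp le_rfl (S.contDiff_f j)) m
    · have := congrArg (fun v : Sp p => v m) (hu.div_eq_zero x hx)
      simp only [PiLp.zero_apply, WithLp.ofLp_sum, Finset.sum_apply] at this
      rw [← this]
      exact Finset.sum_congr rfl fun j _ =>
        (fderiv_apply_coord (hu.differentiableAt_f hΩ j hx) _ m).symm
  refine (IsBigOMesh.sum Finset.univ h).mono fun a c => ?_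
  rw [abs_norm]
  refine le_trans ?_ (le_abs_self _)
  set y := (Q a).integral c fun i x => ∑ j, ((M a).simplex c).normal i j • S.f j (u x)
  have hy : ∀ m, y m = (Q a).integral c fun i x =>
      ∑ j, ((M a).simplex c).normal i j * S.f j (u x) m := fun m => by
    have := (Q a).map_integral (EuclideanSpace.proj m : Sp p →L[ℝ] ℝ).toLinearMap c
      fun i x => ∑ j, ((M a).simplex c).normal i j • S.f j (u x)
    simpa using this
  conv_lhs => rw [← (EuclideanSpace.basisFun (Fin p) ℝ).sum_repr y]
  refine norm_sum_le_of_le _ fun m _ => ?_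
  rw [norm_smul, OrthonormalBasis.norm_eq_one, mul_one, ← hy]
  simp

/-- A smooth solution conserves entropy: by compatibility ∂_j g_j(u) = ⟨∇U(u), ∂_j f_j(u)⟩, whose
sum over j vanishes. -/
theorem isBigOMesh_integral_g (hΩ : IsOpen Ω) (hu : S.IsSmoothSteadySolution Ω u) {ι : Type*}
    {M : ι → Mesh n Ω} {Q : ∀ a, BoundaryQuadrature (M a)} (hquad : QuadratureOrder Q k) :
    IsBigOMesh M (fun a c => (Q a).integral c fun i x =>
      ∑ j, ((M a).simplex c).normal i j * S.g j (u x)) (k + (n + 1) + 1) := by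
  refine isBigOMesh_integral_flux hΩ hquad (φ := fun j x => S.g j (u x))
    (fun j => hu.contDiffOn_comp le_rfl (S.contDiff_g j)) fun x hx => ?_
  have hux := hu.mem x (subset_closure hx)
  have hdu : DifferentiableAt ℝ u x := ((hu.contDiff.of_le one_le_cast).contDiffAt
    (Filter.mem_of_superset (hΩ.mem_nhds hx) subset_closure)).differentiableAt one_ne_zero
  have h : ∀ j, fderiv ℝ (fun y => S.g j (u y)) x (EuclideanSpace.single j 1) =
      inner ℝ (gradient S.U (u x))
        (fderiv ℝ (fun y => S.f j (u y)) x (EuclideanSpace.single j 1)) := fun j => by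
    have hg := ((S.contDiffAt_g j hux).differentiableAt one_ne_zero).hasFDerivAt.comp x
      hdu.hasFDerivAt
    have hf := ((S.contDiffAt_f j hux).differentiableAt one_ne_zero).hasFDerivAt.comp x
      hdu.hasFDerivAt
    rw [show fderiv ℝ (fun y => S.g j (u y)) x = _ from hg.fderiv,
      show fderiv ℝ (fun y => S.f j (u y)) x = _ from hf.fderiv]
    simp only [ContinuousLinearMap.comp_apply]
    rw [S.compatible j _ hux]
  simp only [h, ← inner_sum, hu.div_eq_zero x hx, inner_zero_right]

theorem contDiffOn_entropyVar (hu : S.IsSmoothSteadySolution Ω u) :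
    ContDiffOn ℝ 1 (fun x => S.entropyVar (u x)) (closure Ω) :=
  hu.contDiffOn_comp one_le_cast S.contDiffOn_entropyVar

end EntropySystem.IsSmoothSteadySolution

/-! ### Algebra of the corrected scheme -/

namespace RDScheme

variable {n p k r : ℕ} {Ω : Set (Sp (n + 1))} {M : Mesh n Ω} {Dof : Type*} [Fintype Dof]
  {P : FiniteElement n k Dof} {fhat : Sp (n + 1) → Sp p → Sp p → Sp p} (R : RDScheme P fhat M)

theorem sum_residual (c : M.Cell) : ∑ σ, R.residual c σ = R.totalResidual c := by
  simp only [residual]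
  rw [← _root_.sum_apply, R.sum_β, ContinuousLinearMap.id_apply]

theorem sum_dofs_sub_mean (c : M.Cell) : ∑ σ, (R.dofs c σ - R.mean c) = 0 := by
  have := P.nonempty_dof
  rw [Finset.sum_sub_distrib, Finset.sum_const, mean, Finset.card_univ, ← Nat.cast_smul_eq_nsmul ℝ,
    smul_smul, mul_inv_cancel₀ (Nat.cast_ne_zero.2 Fintype.card_ne_zero), one_smul, sub_self]

/-- Also valid when all V_σ coincide: then r_σ = 0, each V_σ - V̄ being zero. -/
theorem sum_correction (S : EntropySystem n p r) (c : M.Cell) :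
    ∑ σ, R.correction S c σ = 0 := by
  simp only [correction, ← Finset.smul_sum, sum_dofs_sub_mean, smul_zero]

theorem sum_correctedResidual (S : EntropySystem n p r) (c : M.Cell) :
    ∑ σ, R.correctedResidual S c σ = R.totalResidual c := by
  simp only [correctedResidual, Finset.sum_add_distrib, sum_residual, sum_correction, add_zero]

/-- As the corrections sum to zero, V_σ may be replaced by V_σ - V̄ in the pairing, which produces
the spread and cancels the denominator. -/
theorem sum_inner_dofs_correction (S : EntropySystem n p r) (c : M.Cell) (h : R.spread c ≠ 0) :
    ∑ σ, inner ℝ (R.dofs c σ) (R.correction S c σ) = R.defect S c := by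
  have h1 : ∑ σ, inner ℝ (R.mean c) (R.correction S c σ) = 0 := by
    rw [← inner_sum, sum_correction, inner_zero_right]
  rw [← sub_zero (∑ σ, inner ℝ (R.dofs c σ) (R.correction S c σ)), ← h1, ← Finset.sum_sub_distrib]
  have h2 : ∀ σ, inner ℝ (R.dofs c σ) (R.correction S c σ) -
      inner ℝ (R.mean c) (R.correction S c σ) =
      R.defect S c / R.spread c * ‖R.dofs c σ - R.mean c‖ ^ 2 := fun σ => by
    rw [← inner_sub_left, correction, real_inner_smul_right, real_inner_self_eq_norm_sq]
  simp only [h2]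
  rw [← Finset.mul_sum, ← spread, div_mul_cancel₀ _ h]

theorem sum_inner_dofs_correctedResidual (S : EntropySystem n p r) (c : M.Cell)
    (h : R.spread c ≠ 0) :
    ∑ σ, inner ℝ (R.dofs c σ) (R.correctedResidual S c σ) = R.entropyBalance S c := by
  simp only [correctedResidual, inner_add_right, Finset.sum_add_distrib,
    R.sum_inner_dofs_correction S c h, defect]
  ring

theorem norm_correction_le (S : EntropySystem n p r) (c : M.Cell) (σ : Dof) {s : ℝ} (hs : 0 < s)
    (h : s ^ 2 ≤ R.spread c) : ‖R.correction S c σ‖ ≤ |R.defect S c| / s := by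
  have hpos : 0 < R.spread c := lt_of_lt_of_le (by positivity) h
  have hle : ‖R.dofs c σ - R.mean c‖ ≤ Real.sqrt (R.spread c) :=
    Real.le_sqrt_of_sq_le (Finset.single_le_sum
      (f := fun σ => ‖R.dofs c σ - R.mean c‖ ^ 2) (fun _ _ => by positivity) (Finset.mem_univ σ))
  have hsq : s ≤ Real.sqrt (R.spread c) := Real.le_sqrt_of_sq_le h
  rw [correction, norm_smul, Real.norm_eq_abs, abs_div, abs_of_pos hpos]
  calc |R.defect S c| / R.spread c * ‖R.dofs c σ - R.mean c‖
      ≤ |R.defect S c| / R.spread c * Real.sqrt (R.spread c) := by gcongr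
    _ = |R.defect S c| / Real.sqrt (R.spread c) := by
      rw [div_mul_eq_mul_div, div_eq_div_iff hpos.ne' (Real.sqrt_pos.2 hpos).ne', mul_assoc,
        Real.mul_self_sqrt hpos.le]
    _ ≤ |R.defect S c| / s := by gcongr

/-- The entropy defect relative to a constant state `V₀` and to the exact fluxes. -/
theorem defect_eq (S : EntropySystem n p r) (c : M.Cell) (V₀ : Sp p)
    (F : Fin (n + 2) → Sp (n + 1) → Sp p) (G : Fin (n + 2) → Sp (n + 1) → ℝ) :
    R.defect S c = (R.quad.integral c fun i x =>
        (S.entropyFlux fhat ((M.simplex c).normal i) (R.state c x) (R.state (M.across c i) x) -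
          inner ℝ V₀ (fhat ((M.simplex c).normal i) (R.state c x) (R.state (M.across c i) x))) -
        (G i x - inner ℝ V₀ (F i x))) +
      R.quad.integral c G - inner ℝ V₀ (R.quad.integral c F) -
      ∑ σ, inner ℝ (R.dofs c σ - V₀) (R.residual c σ) := by
  have h : ∀ v : Fin (n + 2) → Sp (n + 1) → Sp p,
      inner ℝ V₀ (R.quad.integral c v) = R.quad.integral c fun i x => inner ℝ V₀ (v i x) :=
    fun v => R.quad.map_integral (innerSL ℝ V₀).toLinearMap c v
  simp only [inner_sub_left, Finset.sum_sub_distrib, ← inner_sum, sum_residual, totalResidual,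
    BoundaryQuadrature.integral_sub, ← h, defect, entropyBalance]
  ring

end RDScheme

/-! ### Consistency errors -/

section Consistency

variable {n p k : ℕ} {Ω : Set (Sp (n + 1))} {S : EntropySystem n p (k + 2)}
  {u : Sp (n + 1) → Sp p} {fhat : Sp (n + 1) → Sp p → Sp p → Sp p} {Dof : Type*} [Fintype Dof]
  {P : FiniteElement n k Dof} {ι : Type*} {M : ι → Mesh n Ω}

/-- The numerical entropy flux minus `⟨V₀, f̂⟩`, compared with its exact counterpart. -/
theorem EntropySystem.abs_entropyFlux_sub_le (S : EntropySystem n p (k + 2)) {ν : Sp (n + 1)}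
    (hν : ‖ν‖ = 1) {a b V₀ : Sp p} {y : Sp p} (hy : y ∈ S.D) {ε η τ κ : ℝ}
    (hε : ‖(1 / 2 : ℝ) • (a + b) - S.entropyVar y‖ ≤ ε) (hη : ‖S.entropyVar y - V₀‖ ≤ η)
    (hτ : ‖fhat ν a b - ∑ j, ν j • S.f j y‖ ≤ τ)
    (hκ : ∀ j, |S.potential j ((1 / 2 : ℝ) • (a + b)) - S.potential j (S.entropyVar y) -
      inner ℝ ((1 / 2 : ℝ) • (a + b) - S.entropyVar y) (S.fluxV j (S.entropyVar y))| ≤ κ) :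
    |(S.entropyFlux fhat ν a b - inner ℝ V₀ (fhat ν a b)) -
      (∑ j, ν j * S.g j y - inner ℝ V₀ (∑ j, ν j • S.f j y))| ≤ (ε + η) * τ + (n + 1) * κ := by
  set w := (1 / 2 : ℝ) • (a + b)
  set v := S.entropyVar y
  have hpot : ∀ j, S.potential j v = inner ℝ v (S.f j y) - S.g j y := fun j => by
    rw [potential, S.fluxV_entropyVar j hy, S.consVar_entropyVar hy]
  -- With g_j = ⟨v, f_j⟩ - θ_j, the linear part of θ_j(w) - θ_j(v) absorbs ⟨w - v, f_j⟩. What is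
  -- left is a product of two errors and a Taylor remainder.
  have heq : (S.entropyFlux fhat ν a b - inner ℝ V₀ (fhat ν a b)) -
      (∑ j, ν j * S.g j y - inner ℝ V₀ (∑ j, ν j • S.f j y)) =
      inner ℝ ((w - v) + (v - V₀)) (fhat ν a b - ∑ j, ν j • S.f j y) -
        ∑ j, ν j * (S.potential j w - S.potential j v - inner ℝ (w - v) (S.fluxV j v)) := by
    have : ∑ j, ν j * (S.potential j w - S.potential j v - inner ℝ (w - v) (S.fluxV j v)) =
        ∑ j, ν j * S.potential j w - inner ℝ w (∑ j, ν j • S.f j y) + ∑ j, ν j * S.g j y := by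
      rw [inner_sum, ← Finset.sum_sub_distrib, ← Finset.sum_add_distrib]
      refine Finset.sum_congr rfl fun j _ => ?_
      rw [hpot, S.fluxV_entropyVar j hy, inner_sub_left, real_inner_smul_right]
      ring
    rw [this, sub_add_sub_cancel, inner_sub_left, inner_sub_right, inner_sub_right, entropyFlux]
    ring
  have h1 : |inner ℝ ((w - v) + (v - V₀)) (fhat ν a b - ∑ j, ν j • S.f j y)| ≤ (ε + η) * τ :=
    (abs_real_inner_le_norm _ _).trans
      (mul_le_mul ((norm_add_le _ _).trans (add_le_add hε hη)) hτ (norm_nonneg _)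
        (add_nonneg ((norm_nonneg _).trans hε) ((norm_nonneg _).trans hη)))
  have h2 : |∑ j, ν j * (S.potential j w - S.potential j v - inner ℝ (w - v) (S.fluxV j v))| ≤
      (n + 1) * κ := by
    refine (Finset.abs_sum_le_sum_abs _ _).trans
      ((Finset.sum_le_sum (g := fun _ => κ) fun j _ => ?_).trans_eq (by simp))
    rw [abs_mul]
    have hj : |ν j| ≤ 1 := hν ▸ PiLp.norm_apply_le ν j
    exact (mul_le_of_le_one_left (abs_nonneg _) hj).trans (hκ j)
  rw [heq]
  exact (abs_sub _ _).trans (add_le_add h1 h2)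

/-- The flux error has the order of the approximation; the entropy combination gains one power of h
because V - V₀ = O(h) multiplies that error. -/
theorem exists_pointwise_bounds (hu : S.IsSmoothSteadySolution Ω u) (hfhat : S.IsNumericalFlux fhat)
    (R : ∀ a, RDScheme P fhat (M a))
    (happrox : ∃ C : ℝ, ∃ h₀ : ℝ, 0 < h₀ ∧ ∀ a, (M a).size ≤ h₀ → ∀ c,
      ∀ x ∈ ((M a).simplex c).carrier,
        ‖(R a).state c x - S.entropyVar (u x)‖ ≤ C * (M a).size ^ (k + 1)) :
    ∃ C : ℝ, ∃ h₀ : ℝ, 0 < h₀ ∧ ∀ a, (M a).size ≤ h₀ → ∀ c i,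
      ∀ x ∈ ((M a).simplex c).face i,
        ‖fhat (((M a).simplex c).normal i) ((R a).state c x) ((R a).state ((M a).across c i) x) -
          ∑ j, ((M a).simplex c).normal i j • S.f j (u x)‖ ≤ C * (M a).size ^ (k + 1) ∧
        |(S.entropyFlux fhat (((M a).simplex c).normal i) ((R a).state c x)
            ((R a).state ((M a).across c i) x) -
          inner ℝ (S.entropyVar (u ((M a).simplex c 0))) (fhat (((M a).simplex c).normal i)
            ((R a).state c x) ((R a).state ((M a).across c i) x))) -
          (∑ j, ((M a).simplex c).normal i j * S.g j (u x) -
          inner ℝ (S.entropyVar (u ((M a).simplex c 0)))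
            (∑ j, ((M a).simplex c).normal i j • S.f j (u x)))| ≤ C * (M a).size ^ (k + 2) := by
  rcases isEmpty_or_nonempty ι with hι | ⟨⟨a₀⟩⟩
  · exact ⟨0, 1, one_pos, fun a => isEmptyElim a⟩
  obtain ⟨C₀, h₀, hh₀, H⟩ := happrox
  obtain ⟨L, hL, hlip⟩ := Mesh.exists_lipschitz M hu.contDiffOn_entropyVar
  set A := (fun x => S.entropyVar (u x)) '' closure Ω
  have hAc : IsCompact A := (M a₀).isCompact_closure.image_of_continuousOn
    hu.contDiffOn_entropyVar.continuousOn
  have hAs : A ⊆ S.entropyStates := by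
    rintro _ ⟨x, hx, rfl⟩
    exact mem_image_of_mem _ (hu.mem x hx)
  -- For small h the discrete states lie in this compact thickening, on which the numerical flux is
  -- Lipschitz.
  obtain ⟨ρ, hρ, hρs⟩ := hAc.exists_cthickening_subset_open S.isOpen_entropyStates hAs
  obtain ⟨ρ', hρ', T, hT, htaylor⟩ := S.exists_potential_taylor hAc hAs
  obtain ⟨L', hL'⟩ := hfhat.lipschitz _ hρs (hAc.cthickening (r := ρ))
  set C₁ := |C₀| + 1
  have hC₁ : 0 < C₁ := by positivity
  refine ⟨|L'| * (2 * C₁) + ((C₁ + L) * (|L'| * (2 * C₁)) + (n + 1) * (T * C₁ ^ 2)),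
    min (min h₀ 1) (min (ρ / C₁) (ρ' / C₁)),
    lt_min (lt_min hh₀ one_pos) (lt_min (by positivity) (by positivity)),
    fun a ha c i x hx => ?_⟩
  set h := (M a).size
  have hpos : 0 < h := (M a).size_pos c
  have hle₀ : h ≤ h₀ := ha.trans ((min_le_left _ _).trans (min_le_left _ _))
  have hle1 : h ≤ 1 := ha.trans ((min_le_left _ _).trans (min_le_right _ _))
  have hleρ : C₁ * h ≤ ρ := by
    rw [mul_comm]; exact (le_div_iff₀ hC₁).1 (ha.trans ((min_le_right _ _).trans (min_le_left _ _)))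
  have hleρ' : C₁ * h ≤ ρ' := by
    rw [mul_comm]
    exact (le_div_iff₀ hC₁).1 (ha.trans ((min_le_right _ _).trans (min_le_right _ _)))
  have hε : C₁ * h ^ (k + 1) ≤ C₁ * h :=
    mul_le_mul_of_nonneg_left (pow_le_of_le_one hpos.le hle1 (Nat.succ_ne_zero k)) hC₁.le
  have hxc := ((M a).simplex c).face_subset_carrier i hx
  have hxcl := (M a).carrier_subset c hxc
  have hux := hu.mem x hxcl
  have happ : ∀ c', x ∈ ((M a).simplex c').carrier →
      ‖(R a).state c' x - S.entropyVar (u x)‖ ≤ C₁ * h ^ (k + 1) := fun c' hc' =>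
    (H a hle₀ c' x hc').trans (by gcongr; exact (le_abs_self C₀).trans (by simp [C₁]))
  have hva := happ c hxc
  have hvb := happ _ ((M a).face_subset_across c i hx)
  set va := (R a).state c x
  set vb := (R a).state ((M a).across c i) x
  set v := S.entropyVar (u x)
  have hvA : v ∈ A := mem_image_of_mem _ hxcl
  have hmem : ∀ z, ‖z - v‖ ≤ C₁ * h ^ (k + 1) → z ∈ Metric.cthickening ρ A := fun z hz =>
    Metric.mem_cthickening_of_dist_le z v ρ A hvA
      (by rw [dist_eq_norm]; exact hz.trans (hε.trans hleρ))
  have hvm : v ∈ Metric.cthickening ρ A := Metric.self_subset_cthickening A hvA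
  set ν := ((M a).simplex c).normal i
  have hν : ‖ν‖ = 1 := ((M a).simplex c).norm_normal i
  have hcons : fhat ν v v = ∑ j, ν j • S.f j (u x) := by
    rw [hfhat.consistent ν hν v (hAs hvA), EntropySystem.normalFlux]
    exact Finset.sum_congr rfl fun j _ => by rw [S.fluxV_entropyVar j hux]
  have hτ : ‖fhat ν va vb - ∑ j, ν j • S.f j (u x)‖ ≤ |L'| * (2 * C₁) * h ^ (k + 1) := by
    rw [← hcons]
    refine (hL' ν hν va (hmem _ hva) vb (hmem _ hvb) v hvm v hvm).trans ?_
    calc L' * (‖va - v‖ + ‖vb - v‖) ≤ |L'| * (C₁ * h ^ (k + 1) + C₁ * h ^ (k + 1)) := by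
          gcongr; exact le_abs_self L'
      _ = _ := by ring
  have hw : ‖(1 / 2 : ℝ) • (va + vb) - v‖ ≤ C₁ * h ^ (k + 1) := by
    have : (1 / 2 : ℝ) • (va + vb) - v = (1 / 2 : ℝ) • ((va - v) + (vb - v)) := by module
    rw [this, norm_smul]
    have := norm_add_le (va - v) (vb - v)
    norm_num
    linarith
  have hη : ‖v - S.entropyVar (u ((M a).simplex c 0))‖ ≤ L * h :=
    hlip a c x hxc _ (((M a).simplex c).vertex_mem_carrier 0)
  have hκ := fun j => (htaylor v hvA _ (hw.trans (hε.trans hleρ')) j).trans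
    (mul_le_mul_of_nonneg_left (pow_le_pow_left₀ (norm_nonneg _) hw 2) hT)
  have hmain := S.abs_entropyFlux_sub_le hν hux (hw.trans hε) hη hτ hκ
  have hX : 0 ≤ |L'| * (2 * C₁) := by positivity
  have hY : 0 ≤ (C₁ + L) * (|L'| * (2 * C₁)) + (n + 1) * (T * C₁ ^ 2) := by positivity
  refine ⟨hτ.trans ?_, hmain.trans ?_⟩
  · exact mul_le_mul_of_nonneg_right (le_add_of_nonneg_right hY) (by positivity)
  -- The squared approximation error suffices even for k = 0, where both exponents are 2.
  · have hp : (h ^ (k + 1)) ^ 2 ≤ h ^ (k + 2) := by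
      rw [← pow_mul]; exact pow_le_pow_of_le_one hpos.le hle1 (by omega)
    calc (C₁ * h + L * h) * (|L'| * (2 * C₁) * h ^ (k + 1)) +
          (n + 1) * (T * (C₁ * h ^ (k + 1)) ^ 2)
        = (C₁ + L) * (|L'| * (2 * C₁)) * h ^ (k + 2) +
          (n + 1) * (T * C₁ ^ 2) * (h ^ (k + 1)) ^ 2 := by ring
      _ ≤ (C₁ + L) * (|L'| * (2 * C₁)) * h ^ (k + 2) +
          (n + 1) * (T * C₁ ^ 2) * h ^ (k + 2) := by gcongr
      _ = ((C₁ + L) * (|L'| * (2 * C₁)) + (n + 1) * (T * C₁ ^ 2)) * h ^ (k + 2) := by ring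
      _ ≤ _ := mul_le_mul_of_nonneg_right (le_add_of_nonneg_left hX) (by positivity)

/-- The V_σ need not be point values. As the shape functions sum to one, V_σ - V₀ are the
coefficients of V^h - V₀, which is O(h) on the cell. -/
theorem isBigOMesh_dofs_sub (hu : S.IsSmoothSteadySolution Ω u) (R : ∀ a, RDScheme P fhat (M a))
    (happrox : ∃ C : ℝ, ∃ h₀ : ℝ, 0 < h₀ ∧ ∀ a, (M a).size ≤ h₀ → ∀ c,
      ∀ x ∈ ((M a).simplex c).carrier,
        ‖(R a).state c x - S.entropyVar (u x)‖ ≤ C * (M a).size ^ (k + 1)) (σ : Dof) :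
    IsBigOMesh M (fun a c => ‖(R a).dofs c σ - S.entropyVar (u ((M a).simplex c 0))‖) 1 := by
  obtain ⟨C₀, h₀, hh₀, H⟩ := happrox
  obtain ⟨L, hL, hlip⟩ := Mesh.exists_lipschitz M hu.contDiffOn_entropyVar
  obtain ⟨B, hB, hdof⟩ := P.exists_dof_bound p
  refine ⟨B * (|C₀| + L), min h₀ 1, lt_min hh₀ one_pos, fun a ha c => ?_⟩
  have hpos := (M a).size_pos c
  have hle1 := ha.trans (min_le_right _ _)
  rw [abs_norm, pow_one, mul_assoc]
  refine hdof ((M a).simplex c) (fun σ => (R a).dofs c σ - S.entropyVar (u ((M a).simplex c 0))) _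
    (fun x hx => ?_) σ
  have : ∑ σ, P.shape ((M a).simplex c) σ x •
      ((R a).dofs c σ - S.entropyVar (u ((M a).simplex c 0))) =
      ((R a).state c x - S.entropyVar (u x)) +
        (S.entropyVar (u x) - S.entropyVar (u ((M a).simplex c 0))) := by
    simp only [smul_sub, Finset.sum_sub_distrib, ← Finset.sum_smul, P.sum_shape, one_smul,
      RDScheme.state, sub_add_sub_cancel]
  rw [this, add_mul]
  refine (norm_add_le _ _).trans (add_le_add ((H a (ha.trans (min_le_left _ _)) c x hx).trans ?_)
    (hlip a c x hx _ (((M a).simplex c).vertex_mem_carrier 0)))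
  gcongr
  · exact le_abs_self C₀
  · exact pow_le_of_le_one hpos.le hle1 (Nat.succ_ne_zero k)

theorem isBigOMesh_entropyVar (hu : S.IsSmoothSteadySolution Ω u) :
    IsBigOMesh M (fun a c => ‖S.entropyVar (u ((M a).simplex c 0))‖) 0 := by
  rcases isEmpty_or_nonempty ι with hι | ⟨⟨a₀⟩⟩
  · exact ⟨0, 1, one_pos, fun a => isEmptyElim a⟩
  obtain ⟨B, hB⟩ := (M a₀).isCompact_closure.exists_bound_of_continuousOn
    hu.contDiffOn_entropyVar.continuousOn
  refine IsBigOMesh.of_bound (C := B) fun a c => ?_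
  rw [abs_norm]
  exact hB _ ((M a).carrier_subset c (((M a).simplex c).vertex_mem_carrier 0))

end Consistency

end ResidualDistribution

/-! ### Assembly of the estimates -/

theorem mainTheorem3 {n p k : ℕ} {Ω : Set (Sp (n + 1))} (hΩ : IsOpen Ω)
    (S : EntropySystem n p (k + 2))
    (u : Sp (n + 1) → Sp p) (hu : S.IsSmoothSteadySolution Ω u)
    (fhat : Sp (n + 1) → Sp p → Sp p → Sp p) (hfhat : S.IsNumericalFlux fhat)
    {Dof : Type*} [Fintype Dof] (P : FiniteElement n k Dof)
    {ι : Type*} (M : ι → Mesh n Ω) (R : ∀ a, RDScheme P fhat (M a))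
    (hβ : ∃ B : ℝ, ∀ a c σ, ‖(R a).β c σ‖ ≤ B)
    (hweights : BoundedWeights fun a => (R a).quad)
    (hquad : QuadratureOrder (fun a => (R a).quad) k)
    (happrox : ∃ C : ℝ, ∃ h₀ : ℝ, 0 < h₀ ∧ ∀ a, (M a).size ≤ h₀ → ∀ c,
      ∀ x ∈ ((M a).simplex c).carrier,
        ‖(R a).state c x - S.entropyVar (u x)‖ ≤ C * (M a).size ^ (k + 1)) :
    -- conservation and local entropy conservation of the corrected scheme
    (∀ a c, ∑ σ, (R a).correctedResidual S c σ = (R a).totalResidual c) ∧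
    (∀ a c, (R a).spread c ≠ 0 →
      ∑ σ, inner ℝ ((R a).dofs c σ) ((R a).correctedResidual S c σ) =
        (R a).entropyBalance S c) ∧
    -- size of the entropy defect
    IsBigOMesh M (fun a c => (R a).defect S c) (k + (n + 1) + 1) ∧
    -- the accuracy condition holds for the original scheme and is kept by the correction
    (∀ σ, IsBigOMesh M (fun a c => ‖(R a).residual c σ‖) (k + (n + 1))) ∧
    (∀ δ : ℝ, 0 < δ → ∃ C : ℝ, ∃ h₀ : ℝ, 0 < h₀ ∧ ∀ a, (M a).size ≤ h₀ → ∀ c,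
      δ * (M a).size ^ 2 ≤ (R a).spread c → ∀ σ,
        ‖(R a).correction S c σ‖ ≤ C * (M a).size ^ (k + (n + 1)) ∧
        ‖(R a).correctedResidual S c σ‖ ≤ C * (M a).size ^ (k + (n + 1))) := by
  have hbounds := exists_pointwise_bounds hu hfhat R happrox
  have hF := hu.isBigOMesh_integral_f hΩ hquad
  have hG := hu.isBigOMesh_integral_g hΩ hquad
  have hV := isBigOMesh_entropyVar (M := M) hu
  have hΦ : IsBigOMesh M (fun a c => ‖(R a).totalResidual c‖) (k + (n + 1)) := by
    have h1 := hweights.isBigOMesh (m := k + 1) (v := fun a c i x =>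
      fhat (((M a).simplex c).normal i) ((R a).state c x) ((R a).state ((M a).across c i) x) -
        ∑ j, ((M a).simplex c).normal i j • S.f j (u x)) (by
      obtain ⟨C, h₀, hh, H⟩ := hbounds
      exact ⟨C, h₀, hh, fun a ha c i x hx => (H a ha c i x hx).1⟩)
    -- Here d = n + 1, so the faces contribute the power n = d - 1.
    rw [show k + 1 + n = k + (n + 1) by omega] at h1
    refine (h1.add (hF.of_le (Nat.le_succ _))).mono fun a c => ?_
    rw [abs_norm]
    refine le_trans ?_ (le_abs_self _)
    rw [BoundaryQuadrature.integral_sub]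
    exact norm_le_norm_sub_add _ _
  have hres : ∀ σ, IsBigOMesh M (fun a c => ‖(R a).residual c σ‖) (k + (n + 1)) := fun σ => by
    obtain ⟨B, hB⟩ := hβ
    have h1 := (IsBigOMesh.of_bound (M := M) (e := fun a c => ‖(R a).β c σ‖) (C := B)
      fun a c => by rw [abs_norm]; exact hB a c σ).mul hΦ
    rw [zero_add] at h1
    refine h1.mono fun a c => ?_
    rw [abs_norm]
    exact (((R a).β c σ).le_opNorm _).trans (le_abs_self _)
  have hE : IsBigOMesh M (fun a c => (R a).defect S c) (k + (n + 1) + 1) := by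
    have h1 := hweights.isBigOMesh (m := k + 2) (v := fun a c i x =>
      (S.entropyFlux fhat (((M a).simplex c).normal i) ((R a).state c x)
          ((R a).state ((M a).across c i) x) -
        inner ℝ (S.entropyVar (u ((M a).simplex c 0))) (fhat (((M a).simplex c).normal i)
          ((R a).state c x) ((R a).state ((M a).across c i) x))) -
      (∑ j, ((M a).simplex c).normal i j * S.g j (u x) -
        inner ℝ (S.entropyVar (u ((M a).simplex c 0)))
          (∑ j, ((M a).simplex c).normal i j • S.f j (u x)))) (by
      obtain ⟨C, h₀, hh, H⟩ := hbounds
      exact ⟨C, h₀, hh, fun a ha c i x hx => (H a ha c i x hx).2⟩)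
    rw [show k + 2 + n = k + (n + 1) + 1 by omega] at h1
    have h2 := hV.mul hF
    rw [zero_add] at h2
    have h3 := IsBigOMesh.sum Finset.univ fun σ => (isBigOMesh_dofs_sub hu R happrox σ).mul (hres σ)
    rw [add_comm 1] at h3
    have hG' := hG.mono (e' := fun a c => |(R a).quad.integral c fun i x =>
      ∑ j, ((M a).simplex c).normal i j * S.g j (u x)|) fun a c => (abs_abs _).le
    refine (((h1.add hG').add h2).add h3).mono fun a c => ?_
    refine le_trans ?_ (le_abs_self _)
    rw [(R a).defect_eq S c (S.entropyVar (u ((M a).simplex c 0)))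
      (fun i x => ∑ j, ((M a).simplex c).normal i j • S.f j (u x))
      (fun i x => ∑ j, ((M a).simplex c).normal i j * S.g j (u x))]
    refine (abs_sub _ _).trans (add_le_add ((abs_sub _ _).trans
      (add_le_add (abs_add_le _ _) (abs_real_inner_le_norm _ _))) ?_)
    exact (Finset.abs_sum_le_sum_abs _ _).trans
      (Finset.sum_le_sum fun σ _ => abs_real_inner_le_norm _ _)
  refine ⟨fun a c => (R a).sum_correctedResidual S c,
    fun a c h => (R a).sum_inner_dofs_correctedResidual S c h, hE, hres, fun δ hδ => ?_⟩
  obtain ⟨C, hC, h₀, hh₀, H⟩ := hE.exists_nonneg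
  obtain ⟨C', hC', h₀', hh₀', H'⟩ :=
    (IsBigOMesh.sum (e := fun σ a c => ‖(R a).residual c σ‖) Finset.univ hres).exists_nonneg
  refine ⟨C / Real.sqrt δ + C', min h₀ h₀', lt_min hh₀ hh₀', fun a ha c hspread σ => ?_⟩
  have hpos := (M a).size_pos c
  have hδ' := Real.sqrt_pos.2 hδ
  have hcorr : ‖(R a).correction S c σ‖ ≤ C / Real.sqrt δ * (M a).size ^ (k + (n + 1)) := by
    refine ((R a).norm_correction_le S c σ (s := Real.sqrt δ * (M a).size) (by positivity)
      (by rwa [mul_pow, Real.sq_sqrt hδ.le])).trans ?_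
    rw [div_le_iff₀ (by positivity)]
    refine (H a (ha.trans (min_le_left _ _)) c).trans_eq ?_
    field_simp
    ring
  have hresσ : ‖(R a).residual c σ‖ ≤ C' * (M a).size ^ (k + (n + 1)) :=
    ((Finset.single_le_sum (f := fun σ => ‖(R a).residual c σ‖) (fun _ _ => norm_nonneg _)
      (Finset.mem_univ σ)).trans (le_abs_self _)).trans (H' a (ha.trans (min_le_right _ _)) c)
  rw [add_mul]
  refine ⟨hcorr.trans (le_add_of_nonneg_right (by positivity)), (norm_add_le _ _).trans ?_⟩
  linarith
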